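/- **Setting.** *Usages.* On $L=\{0,1,\infty\}$ let $0\oplus a=a\oplus 0=a$, $\infty\oplus\infty=\infty$, and $\oplus$ be undefined otherwise; extend it componentwise to $L^3$ (emit, receive during the instant, receive at the end of the instant). The five main usages are $e_1=(\infty,0,\infty)$, $e_2=(1,\infty,\infty)$, $e_3=(\infty,0,1)$, $e_4=(1,0,1)$, $e_5=(1,1,0)$; derived usages are obtained by turning some $1$'s into $0$'s. A signal usage of kind $i$ is a word $xy^\omega$ with $x,y\in L^3$ equal to or derived from $e_i$, taken together with its kind; addition and the order $u\ge v\iff\exists c\,(v\oplus c=u)$ are characterwise and only within one kind, and $\uparrow(xy^\omega)=y^\omega$. A usage is affine if it contains a $1$, uniform if $x=y$, neutral if it is the neutral element of its kind, affine preserving if its kind is $3$, $4$ or $5$. *Types.* $\kappa::=C_\infty(\vec\kappa)\mid \mathsf{Set}_\infty(\kappa)\mid \mathsf{Sig}_u(\kappa)$ ($u$ neutral); $\lambda::=C_1(\vec\sigma)\mid \mathsf{Set}_1(\sigma)\mid \mathsf{Sig}_u(\kappa)\mid \mathsf{Sig}_v(\lambda)$ ($u$ affine uniform, $v$ affine preserving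 and uniform); $\sigma::=\kappa\mid\lambda$; $\rho::=\sigma\mid \mathsf{Sig}_u(\kappa)\mid \mathsf{Sig}_v(\lambda)$ ($v$ affine preserving). Here $C$ ranges over the inductive types, $\mathsf{List}$ among them; each constructor of $C_x(\vec\sigma)$ has arguments of type some $\sigma_i$ or $C_x(\vec\sigma)$ itself, and $\mathsf{nil},\mathsf{cons}$ are constructors both of $\mathsf{List}_x(\sigma)$ and of $\mathsf{Set}_x(\sigma)$. Types are added by $\mathsf{Op}_{u}(\vec\sigma)\oplus\mathsf{Op}_{u'}(\vec\sigma)=\mathsf{Op}_{u\oplus u'}(\vec\sigma)$. A context $\Gamma$ is a finite partial map from variables to types (signal names having signal types, other variables other types); $\Gamma\oplus\Gamma'$ is pointwise, and is defined if all the sums of types are; $\uparrow\Gamma$ replaces $\mathsf{Sig}_u(\sigma)$ by $\mathsf{Sig}_{\uparrow u}(\sigma)$. *Programs.* Values $v$ are built from signal names and constructors; expressions $e$ from variables, constructors and function symbols; expressions $r$ may also contain dereferenced signals $!s$. Programs are $0$, $A(\vec e)$, emissions $\overline{s}e$ (possibly underlined, $\underline{\overline{s}e}$), $s(x).P,A(\vec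 r)$, $[s_1=s_2]P_1,P_2$, $[u\unrhd c(\vec x)]P_1,P_2$, $\nu s{:}\rho\,P$, $P_1\mid P_2$. *Typing.* $u(0)$ is the first character of $u$ and $u(0)_j$ its $j$-th component; comparisons are within one kind. In every rule with an iterated sum the sum starts with an arbitrary context $\Gamma_0$. - Expressions: $\Gamma,x{:}\mathsf{Op}_u(\vec\sigma)\vdash x:\mathsf{Op}_{u'}(\vec\sigma)$ if $u\ge u'$; $\Gamma_0\oplus\Gamma_1\oplus\cdots\oplus\Gamma_n\vdash k(e_1,\dots,e_n):\sigma$ if $k:(\sigma_1,\dots,\sigma_n)\to\sigma$ is a constructor or function symbol and $\Gamma_i\vdash e_i:\sigma_i$. - End of instant: $\Gamma,x{:}\rho\vdash[x]:\rho$ for $\rho$ not a signal type; $\Gamma,s{:}\mathsf{Sig}_{xy^\omega}(\sigma)\vdash[s]:\mathsf{Sig}_u(\sigma)$ if $y^\omega\ge u$; the rule for $k$ as above; $\Gamma,s{:}\mathsf{Sig}_u(\sigma)\vdash[!s]:\mathsf{Set}_x(\sigma)$ if $u(0)\ge(\infty,0,\infty)$ and $x=\infty$, or $u(0)\ge(\infty,0,1)$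 and $x=1$; $\Gamma,s{:}\mathsf{Sig}_u(\sigma)\vdash[!s]:\mathsf{List}_x(\sigma)$ if $u(0)\ge(0,\infty,\infty)$ and $x=\infty$, or $u(0)\ge(0,0,1)$ and $x=1$. - Calls, for $A:(\sigma_1,\dots,\sigma_n)$: $\Gamma_0\oplus\Gamma_1\oplus\cdots\oplus\Gamma_n\vdash A(e_1,\dots,e_n)$ if $\Gamma_i\vdash e_i:\sigma_i$; $\Gamma_0\oplus\Gamma_1\oplus\cdots\oplus\Gamma_n\vdash[A(r_1,\dots,r_n)]$ if $\Gamma_i\vdash[r_i]:\sigma_i$. - Other programs: $\Gamma\vdash0$. $\Gamma_1\oplus\Gamma_2\vdash\overline{s}e$ if $\Gamma_1\vdash s:\mathsf{Sig}_u(\sigma)$, $u(0)_1\ne0$, $\Gamma_2\vdash e:\sigma$. $\Gamma\vdash\underline{\overline{s}e}$ if $\Gamma\vdash s:\mathsf{Sig}_u(\sigma)$, $u(0)=(1,1,0)$. $\Gamma\vdash\nu s{:}\mathsf{Sig}_u(\sigma)\,P$ if $\Gamma,s{:}\mathsf{Sig}_u(\sigma)\vdash P$. $\Gamma_1\oplus\Gamma_2\vdash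 s(x).P,K$ if $\Gamma_1\vdash s:\mathsf{Sig}_u(\sigma)$, $u(0)_2\neq0$, $\Gamma_2,x{:}\sigma\vdash P$, $\Gamma_1\oplus\Gamma_2\vdash[K]$. $\Gamma\vdash[s_1=s_2]P_1,P_2$ if $s_1,s_2\in\mathrm{dom}(\Gamma)$, $\Gamma\vdash P_1$, $\Gamma\vdash P_2$. $\Gamma_1\oplus\Gamma_2\vdash[u\unrhd c(\vec x)]P_1,P_2$ if $c:(\vec\sigma)\to\sigma$, $\Gamma_1\vdash u:\sigma$, $\Gamma_2,\vec x{:}\vec\sigma\vdash P_1$, $\Gamma_1\oplus\Gamma_2\vdash P_2$. $\Gamma_1\oplus\Gamma_2\vdash P_1\mid P_2$ if $\Gamma_i\vdash P_i$. *Semantics.* $e\Downarrow v$ is evaluation. $V$ and $E$ map signal names to lists of distinct values and to finite sets of values. The transitions (up to renaming of bound names, with the symmetric rules) are as follows, where $\mu$ ranges over $\tau$, $\nu\vec t{:}\vec\rho\,\overline sv$, $s?v$. If $e\Downarrow v$, then $\overline se$ and $\underline{\overline se}$ have a transition $\overline sv$ to $\underline{\overline se}$. $s(x).P,K\xrightarrow{s?v}[v/x]P$.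 $P\xrightarrow{sv}P\mid\overline sv$. $A(\vec e)\xrightarrow{\tau}[\vec v/\vec x]P$ if $A(\vec x)=P$ and $\vec e\Downarrow\vec v$. $[s=s]P_1,P_2\xrightarrow\tau P_1$, and $[s_1=s_2]P_1,P_2\xrightarrow\tau P_2$ if $s_1\neq s_2$. $[c(\vec v)\unrhd c(\vec x)]P_1,P_2\xrightarrow\tau[\vec v/\vec x]P_1$, and $[v\unrhd c(\vec x)]P_1,P_2\xrightarrow\tau P_2$ if $v$ does not match. If $P_1\xrightarrow\mu P_1'$ and no bound name of $\mu$ is free in $P_2$, then $P_1\mid P_2\xrightarrow\mu P_1'\mid P_2$. If $P_1\xrightarrow{\nu\vec t:\vec\rho\,\overline sv}P_1'$, $P_2\xrightarrow{s?v}P_2'$ and no $t_i$ is free in $P_2$, then $P_1\mid P_2\xrightarrow\tau\nu\vec t{:}\vec\rho\,(P_1'\mid P_2')$. If $P\xrightarrow\mu P'$ and $t$ is not a name of $\mu$, then $\nu t{:}\rho\,P\xrightarrow\mu\nu t{:}\rho\,P'$. If $P\xrightarrow{\nu\vec t:\vec\rho\,\overline sv}P'$, $t'\ne s$, and $t'$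 occurs in $v$ but not in $\vec t$, then $\nu t'{:}\rho'\,P\xrightarrow{\nu t':\rho',\vec t:\vec\rho\,\overline sv}P'$. End of instant: $0\xrightarrow{\emptyset,V}0$; $\overline se$ and $\underline{\overline se}$ have a transition $([\{v\}/s],V)$ to $0$ if $e\Downarrow v$ and $v$ occurs in $V(s)$; $s(x).P,K\xrightarrow{\emptyset,V}V(K)$ if $V(s)=[\,]$; $P_1\mid P_2\xrightarrow{E_1\cup E_2,V}P_1'\mid P_2'$ if $P_i\xrightarrow{E_i,V}P_i'$. Finally $P\xrightarrow N\nu\vec s{:}{\uparrow}\vec\rho\,P''$ if lifting restrictions out of parallel compositions turns $P$ into $\nu\vec s{:}\vec\rho\,P'$, $V\Vdash E$ and $P'\xrightarrow{E,V}P''$. Here $V(A(\vec r))$ is $A(\vec r)$ with each $!s$ replaced by the list $V(s)$, and $V\Vdash E$ means that, for every $s$, $V(s)$ is an enumeration without repetition of $E(s)$. Weak transitions are $\Rightarrow^\tau=(\xrightarrow\tau)^*$, $\Rightarrow^N=\Rightarrow^\tau\xrightarrow N$, and $\Rightarrow^\alpha=\Rightarrow^\tau\xrightarrow\alpha\Rightarrow^\tau$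 otherwise. $\approx$ is the largest symmetric relation $\mathcal R$ such that if $P\,\mathcal R\,Q$, $P\xrightarrow\alpha P'$ with $\alpha$ one of $\tau$, $\nu\vec t{:}\vec\rho\,\overline sv$, $sv$, $N$, and no bound name of $\alpha$ is free in $Q$, then $Q\Rightarrow^\alpha Q'$ and $P'\,\mathcal R\,Q'$ for some $Q'$. *Standing assumptions.* Let $\sim_\rho$ be the least equivalence on values such that $c(\vec v)\sim c(\vec u)$ at an inductive type if the arguments are equivalent at the argument types of $c$, and $[v_1;\dots;v_n]\sim_{\mathsf{Set}_x(\sigma)}[u_1;\dots;u_m]$ if the sets $\{v_1,\dots,v_n\}$ and $\{u_1,\dots,u_m\}$ have enumerations (repetitions allowed) of the same length which are elementwise $\sim_\sigma$ up to a permutation. Each function symbol $f$ has a type $(\kappa_1,\dots,\kappa_n)\to\kappa$; on arguments of suitable type it has exactly one result; the signal names of its results occur in the arguments; it preserves $\sim$ and typing. Each thread identifier $A$ has a type $(\sigma_1,\dots,\sigma_n)$ and a unique equation $A(x_1,\dots,x_n)=P$, the $x_i$ being distinct and the free variables of $P$ among them; $x_1{:}\sigma_1,\dots,x_n{:}\sigma_n\vdash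 P$; and $v_i\sim_{\sigma_i}u_i$ for all $i$ implies $A(\vec v)\approx A(\vec u)$. **Lemma (substitution, end of instant).** Let $V$ map signal names to lists of distinct values, only finitely many of them non-empty, and let $P_V$ be the parallel composition of the emissions $\overline sv$ for all signals $s$ and all $v$ in $V(s)$. Suppose $\Gamma\vdash[A(\vec r)]$, $\Gamma'\vdash P_V$, and $\Gamma\oplus\Gamma'$ is defined. (1) Then $\uparrow(\Gamma\oplus\Gamma')\vdash V(A(\vec r))$. (2) If moreover there are $V'$, $E$ with $V\Vdash E$ and $V'\Vdash E$, then $V(A(\vec r))\approx V'(A(\vec r))$. -/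

import Mathlib

namespace SPi

/-! ## Usages -/

/-- The set `L = {0, 1, ∞}`. -/
inductive L
  | zero
  | one
  | inf
  deriving DecidableEq

/-- Partial addition on `L`: `0 ⊕ a = a ⊕ 0 = a`, `∞ ⊕ ∞ = ∞`, undefined otherwise. -/
def L.add : L → L → Option L
  | .zero, a => some a
  | a, .zero => some a
  | .inf, .inf => some .inf
  | _, _ => none

/-- Elements of `L³`: (emit, receive within the instant, receive at the end of the instant). -/
structure U3 where
  c1 : L
  c2 : L
  c3 : L
  deriving DecidableEq

/-- `U3.Add x y z` : the componentwise sum `x ⊕ y` is defined and equal to `z`. -/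
def U3.Add (x y z : U3) : Prop :=
  L.add x.c1 y.c1 = some z.c1 ∧ L.add x.c2 y.c2 = some z.c2 ∧ L.add x.c3 y.c3 = some z.c3

/-- The five kinds of signal usages. -/
inductive Kind
  | k1
  | k2
  | k3
  | k4
  | k5
  deriving DecidableEq

/-- The main usage of each kind. -/
def Kind.main : Kind → U3
  | .k1 => ⟨.inf, .zero, .inf⟩
  | .k2 => ⟨.one, .inf, .inf⟩
  | .k3 => ⟨.inf, .zero, .one⟩
  | .k4 => ⟨.one, .zero, .one⟩
  | .k5 => ⟨.one, .one, .zero⟩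

/-- `a` is `b`, or `b = 1` has been turned into `a = 0`. -/
def L.DerivedFrom (a b : L) : Prop := a = b ∨ (b = .one ∧ a = .zero)

/-- `x` is the main usage of kind `k` or derived from it by turning some `1` into `0`. -/
def U3.DerivedFrom (x : U3) (k : Kind) : Prop :=
  x.c1.DerivedFrom k.main.c1 ∧ x.c2.DerivedFrom k.main.c2 ∧ x.c3.DerivedFrom k.main.c3

/-- `x ≥ y` in `L³`, for usages derived from the same main usage. -/
def U3.Ge (x y : U3) : Prop :=
  ∃ k : Kind, x.DerivedFrom k ∧ y.DerivedFrom k ∧ ∃ c : U3, c.DerivedFrom k ∧ U3.Add y c x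

/-- A signal usage: a word `x y^ω` (`x = hd`, `y = tl`) together with its kind. -/
structure Usage where
  kind : Kind
  hd : U3
  tl : U3
  hd_derived : hd.DerivedFrom kind
  tl_derived : tl.DerivedFrom kind

/-- `Usage.Add u v w` : `u ⊕ v` is defined and equal to `w`
(same kind, characterwise addition, result again of this kind). -/
def Usage.Add (u v w : Usage) : Prop :=
  u.kind = w.kind ∧ v.kind = w.kind ∧ U3.Add u.hd v.hd w.hd ∧ U3.Add u.tl v.tl w.tl

/-- `u ≥ v`. -/
def Usage.Ge (u v : Usage) : Prop := ∃ c : Usage, Usage.Add v c u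

/-- The shift `↑u`: the first character is removed. -/
def Usage.shift (u : Usage) : Usage := ⟨u.kind, u.tl, u.tl, u.tl_derived, u.tl_derived⟩

def U3.HasOne (x : U3) : Prop := x.c1 = .one ∨ x.c2 = .one ∨ x.c3 = .one

/-- A usage is affine if it contains a `1`. -/
def Usage.Affine (u : Usage) : Prop := u.hd.HasOne ∨ u.tl.HasOne

/-- A usage is uniform if it has the shape `x^ω`. -/
def Usage.Uniform (u : Usage) : Prop := u.hd = u.tl

/-- A usage is neutral if it is the neutral element of the usages of its kind. -/
def Usage.Neutral (u : Usage) : Prop := ∀ v : Usage, v.kind = u.kind → Usage.Add u v v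

/-- The usages of kinds 3, 4, 5 are affine preserving. -/
def Usage.AffPres (u : Usage) : Prop := u.kind = .k3 ∨ u.kind = .k4 ∨ u.kind = .k5

/-- The usages `1`, `∞` of inductive types and set types. -/
inductive Mult
  | one
  | inf
  deriving DecidableEq

def Mult.toL : Mult → L
  | .one => .one
  | .inf => .inf

def Mult.Add (x y z : Mult) : Prop := L.add x.toL y.toL = some z.toL

def Mult.Ge (x y : Mult) : Prop := ∃ c : L, L.add y.toL c = some x.toL

/-! ## Names, variables, terms -/

/-- Variables: signal names and variables of other types. -/
inductive Var
  | sig (s : ℕ)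
  | var (x : ℕ)
  deriving DecidableEq

def Var.IsSig : Var → Prop
  | .sig _ => True
  | .var _ => False

/-- The symbols of a calculus. An inductive type name `C` has a number of type parameters;
a constructor `c` belongs to one inductive type `C`, and each of its arguments has as type either
the `i`-th parameter (`some i`) or the inductive type itself (`none`). Lists and sets, with
constructors `nil` and `cons`, are built in and not part of `Ind`, `Con`. -/
structure Sgn where
  Ind : Type
  indArity : Ind → ℕ
  Con : Type
  conInd : Con → Ind
  conArgs : (c : Con) → List (Option (Fin (indArity (conInd c))))
  Fun : Type
  funArity : Fun → ℕ
  Thr : Type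
  thrArity : Thr → ℕ

/-- Constructors. -/
inductive Cnst (S : Sgn) : Type
  | nil
  | cons
  | other (c : S.Con)

def Cnst.arity {S : Sgn} : Cnst S → ℕ
  | .nil => 0
  | .cons => 2
  | .other c => (S.conArgs c).length

/-- Values: terms built out of constructors and signal names. -/
inductive Val (S : Sgn) : Type
  | sig (s : ℕ)
  | con (c : Cnst S) (vs : Fin c.arity → Val S)

/-- The list value `[v₁; …; vₙ]`. -/
def Val.ofList {S : Sgn} : List (Val S) → Val S
  | [] => .con .nil Fin.elim0
  | v :: l => .con .cons ![v, Val.ofList l]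

/-- The signal names of a value. -/
def Val.fn {S : Sgn} : Val S → Set ℕ
  | .sig s => {s}
  | .con _ vs => ⋃ i, (vs i).fn

/-- An occurrence of a signal name: a free name, or a bound one (de Bruijn index). -/
inductive SigRef
  | name (s : ℕ)
  | bvar (i : ℕ)

/-- Terms. Free variables are named and bound ones are de Bruijn indices, so that terms are
identified up to renaming of bound variables. Function symbols are allowed if `fn = true`
and dereferenced signals `!s` if `dr = true`. -/
inductive Tm (S : Sgn) (fn dr : Bool) : Type
  | fvar (x : Var)
  | bvar (i : ℕ)
  | deref (h : dr = true) (s : SigRef)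
  | con (c : Cnst S) (ts : Fin c.arity → Tm S fn dr)
  | app (h : fn = true) (f : S.Fun) (ts : Fin (S.funArity f) → Tm S fn dr)

/-- Variables or values, as matched against patterns. -/
abbrev Scrut (S : Sgn) := Tm S false false
/-- Expressions. -/
abbrev Exp (S : Sgn) := Tm S true false
/-- Expressions with dereferenciation. -/
abbrev Rexp (S : Sgn) := Tm S true true

def Val.toTm {S : Sgn} {a d : Bool} : Val S → Tm S a d
  | .sig s => .fvar (.sig s)
  | .con c vs => .con c (fun i => (vs i).toTm)

/-! ## Types -/

/-- Raw types; `list x σ` is the inductive type `List_x(σ)`. -/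
inductive Ty (S : Sgn) : Type
  | ind (C : S.Ind) (x : Mult) (ps : Fin (S.indArity C) → Ty S)
  | list (x : Mult) (σ : Ty S)
  | set (x : Mult) (σ : Ty S)
  | sig (u : Usage) (σ : Ty S)

namespace Ty
variable {S : Sgn}

def IsSig : Ty S → Prop
  | .sig _ _ => True
  | _ => False

/-- The non-affine types `κ`. -/
def IsK : Ty S → Prop
  | .ind _ x ps => x = .inf ∧ ∀ i, (ps i).IsK
  | .list x σ => x = .inf ∧ σ.IsK
  | .set x σ => x = .inf ∧ σ.IsK
  | .sig u σ => u.Neutral ∧ σ.IsK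

/-- The affine uniform types `λ`. -/
def IsL : Ty S → Prop
  | .ind _ x ps => x = .one ∧ ∀ i, (ps i).IsK ∨ (ps i).IsL
  | .list x σ => x = .one ∧ (σ.IsK ∨ σ.IsL)
  | .set x σ => x = .one ∧ (σ.IsK ∨ σ.IsL)
  | .sig u σ => (u.Affine ∧ u.Uniform ∧ σ.IsK) ∨ (u.AffPres ∧ u.Uniform ∧ σ.IsL)

/-- The uniform types `σ`. -/
def IsUniform (τ : Ty S) : Prop := τ.IsK ∨ τ.IsL

/-- All types `ρ`. -/
def IsRho (τ : Ty S) : Prop :=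
  τ.IsUniform ∨ ∃ u σ, τ = .sig u σ ∧ (σ.IsK ∨ (u.AffPres ∧ σ.IsL))

/-- `Ty.Add ρ₁ ρ₂ ρ` : `ρ₁ ⊕ ρ₂` is defined and equal to `ρ`. -/
inductive Add : Ty S → Ty S → Ty S → Prop
  | ind {C : S.Ind} {x y z : Mult} {ps : Fin (S.indArity C) → Ty S} :
      Mult.Add x y z → Add (.ind C x ps) (.ind C y ps) (.ind C z ps)
  | list {x y z : Mult} {σ : Ty S} : Mult.Add x y z → Add (.list x σ) (.list y σ) (.list z σ)
  | set {x y z : Mult} {σ : Ty S} : Mult.Add x y z → Add (.set x σ) (.set y σ) (.set z σ)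
  | sig {u v w : Usage} {σ : Ty S} : Usage.Add u v w → Add (.sig u σ) (.sig v σ) (.sig w σ)

/-- `Ty.Ge ρ ρ'` : `ρ = Op_u(σ⃗)` and `ρ' = Op_{u'}(σ⃗)` with `u ≥ u'`. -/
inductive Ge : Ty S → Ty S → Prop
  | ind {C : S.Ind} {x y : Mult} {ps : Fin (S.indArity C) → Ty S} :
      Mult.Ge x y → Ge (.ind C x ps) (.ind C y ps)
  | list {x y : Mult} {σ : Ty S} : Mult.Ge x y → Ge (.list x σ) (.list y σ)
  | set {x y : Mult} {σ : Ty S} : Mult.Ge x y → Ge (.set x σ) (.set y σ)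
  | sig {u v : Usage} {σ : Ty S} : Usage.Ge u v → Ge (.sig u σ) (.sig v σ)

/-- `↑ρ`. -/
def shift : Ty S → Ty S
  | .sig u σ => .sig u.shift σ
  | τ => τ

theorem isRho_shift {τ : Ty S} (h : τ.IsRho) : τ.shift.IsRho := by
  cases τ with
  | ind C x ps => exact h
  | list x σ => exact h
  | set x σ => exact h
  | sig u σ =>
    refine Or.inr ⟨u.shift, σ, rfl, ?_⟩
    rcases h with (h | h) | ⟨u', σ', e, h⟩
    · exact Or.inl h.2
    · rcases h with h | h
      · exact Or.inl h.2.2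
      · exact Or.inr ⟨h.1, h.2.2⟩
    · cases e
      exact h

theorem isSig_shift (τ : Ty S) : τ.shift.IsSig ↔ τ.IsSig := by
  cases τ <;> exact Iff.rfl

end Ty

/-- `IndCon c σs τ` : `c : (σ₁, …, σₙ) → τ` for a (well-formed) inductive type `τ`. -/
inductive IndCon {S : Sgn} : (c : Cnst S) → (Fin c.arity → Ty S) → Ty S → Prop
  | nil {x : Mult} {σ : Ty S} (h : (Ty.list x σ).IsUniform) :
      IndCon .nil Fin.elim0 (.list x σ)
  | cons {x : Mult} {σ : Ty S} (h : (Ty.list x σ).IsUniform) :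
      IndCon .cons ![σ, .list x σ] (.list x σ)
  | other {c : S.Con} {x : Mult} {ps : Fin (S.indArity (S.conInd c)) → Ty S}
      (h : (Ty.ind (S.conInd c) x ps).IsUniform) :
      IndCon (.other c)
        (fun i => ((S.conArgs c).get i).elim (Ty.ind (S.conInd c) x ps) ps)
        (.ind (S.conInd c) x ps)

/-- `ConTy c σs τ` : `c : (σ₁, …, σₙ) → τ` for an inductive type or a set type `τ`. -/
inductive ConTy {S : Sgn} : (c : Cnst S) → (Fin c.arity → Ty S) → Ty S → Prop
  | ind {c : Cnst S} {σs : Fin c.arity → Ty S} {τ : Ty S} : IndCon c σs τ → ConTy c σs τ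
  | setNil {x : Mult} {σ : Ty S} (h : (Ty.set x σ).IsUniform) :
      ConTy .nil Fin.elim0 (.set x σ)
  | setCons {x : Mult} {σ : Ty S} (h : (Ty.set x σ).IsUniform) :
      ConTy .cons ![σ, .set x σ] (.set x σ)

/-- `ValEq ρ v u` : the equivalence `v ∼_ρ u` on values. In the clause for sets, `v` and `u` are
enumerations (repetitions allowed) of the sets of elements of the two lists. -/
inductive ValEq {S : Sgn} : Ty S → Val S → Val S → Prop
  | refl (τ : Ty S) (v : Val S) : ValEq τ v v
  | symm {τ : Ty S} {v u : Val S} : ValEq τ v u → ValEq τ u v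
  | trans {τ : Ty S} {v u w : Val S} : ValEq τ v u → ValEq τ u w → ValEq τ v w
  | con {c : Cnst S} {σs : Fin c.arity → Ty S} {τ : Ty S} {vs us : Fin c.arity → Val S} :
      IndCon c σs τ → (∀ i, ValEq (σs i) (vs i) (us i)) → ValEq τ (.con c vs) (.con c us)
  | set {x : Mult} {σ : Ty S} {l l' : List (Val S)} {n : ℕ} (v u : Fin n → Val S)
      (π : Equiv.Perm (Fin n)) :
      (∀ a, a ∈ l ↔ ∃ i, v i = a) → (∀ a, a ∈ l' ↔ ∃ i, u i = a) →
      (∀ i, ValEq σ (v i) (u (π i))) → ValEq (.set x σ) (Val.ofList l) (Val.ofList l')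

/-! ## Contexts -/

/-- A context: a finite partial function from variables to types, which gives signal types
to signal names and other types to the other variables. -/
structure Ctx (S : Sgn) where
  lookup : Var → Option (Ty S)
  finite : {x | lookup x ≠ none}.Finite
  wf : ∀ x τ, lookup x = some τ → τ.IsRho
  sorted : ∀ x τ, lookup x = some τ → (x.IsSig ↔ τ.IsSig)

namespace Ctx
variable {S : Sgn}

def empty : Ctx S where
  lookup := fun _ => none
  finite := by simp
  wf := by simp
  sorted := by simp

/-- Pointwise addition of partial functions into types. -/
inductive OptAdd : Option (Ty S) → Option (Ty S) → Option (Ty S) → Prop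
  | left (o : Option (Ty S)) : OptAdd none o o
  | right (o : Option (Ty S)) : OptAdd o none o
  | both {ρ₁ ρ₂ ρ : Ty S} : Ty.Add ρ₁ ρ₂ ρ → OptAdd (some ρ₁) (some ρ₂) (some ρ)

/-- `Ctx.Add Γ₁ Γ₂ Γ` : `Γ₁ ⊕ Γ₂` is defined and equal to `Γ`. -/
def Add (Γ₁ Γ₂ Γ : Ctx S) : Prop := ∀ x, OptAdd (Γ₁.lookup x) (Γ₂.lookup x) (Γ.lookup x)

/-- `Ctx.Sum Γ₀ [Γ₁, …, Γₙ] Γ` : `Γ₀ ⊕ Γ₁ ⊕ ⋯ ⊕ Γₙ` is defined and equal to `Γ`. -/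
inductive Sum : Ctx S → List (Ctx S) → Ctx S → Prop
  | nil (Γ : Ctx S) : Sum Γ [] Γ
  | cons {Γ₀ Γ₁ Δ Γ : Ctx S} {Γs : List (Ctx S)} : Add Γ₀ Γ₁ Δ → Sum Δ Γs Γ → Sum Γ₀ (Γ₁ :: Γs) Γ

/-- `Ctx.Ext Γ xs σs Γ'` : `Γ' = Γ, x₁ : σ₁, …, xₙ : σₙ` (the `xᵢ` distinct, not in `dom Γ`). -/
def Ext (Γ : Ctx S) {n : ℕ} (xs : Fin n → Var) (σs : Fin n → Ty S) (Γ' : Ctx S) : Prop :=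
  Function.Injective xs ∧ (∀ i, Γ.lookup (xs i) = none) ∧
    (∀ i, Γ'.lookup (xs i) = some (σs i)) ∧
    ∀ y, (∀ i, y ≠ xs i) → Γ'.lookup y = Γ.lookup y

/-- The shift `↑Γ`. -/
def shift (Γ : Ctx S) : Ctx S where
  lookup := fun x => (Γ.lookup x).map Ty.shift
  finite := Γ.finite.subset (fun x hx h => hx (by simp [h]))
  wf := by
    intro x τ h
    obtain ⟨τ', h', rfl⟩ := Option.map_eq_some_iff.1 h
    exact Ty.isRho_shift (Γ.wf x τ' h')
  sorted := by
    intro x τ h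
    obtain ⟨τ', h', rfl⟩ := Option.map_eq_some_iff.1 h
    rw [Ty.isSig_shift]
    exact Γ.sorted x τ' h'

end Ctx

/-! ## Programs -/

/-- Programs. `emit m s e` is the emission of `e` on `s`, underlined if `m = true`.
`present s P A rs` is `s(x).P, A(rs)` and binds index `0` in `P`;
`matchCon u c P₁ P₂` is `[u ⊵ c(x₁,…,xₙ)] P₁, P₂` and binds the indices `0, …, n-1` in `P₁`;
`nu ρ P` is `ν s : ρ. P` and binds index `0` in `P`. -/
inductive Proc (S : Sgn) : Type
  | zero
  | call (A : S.Thr) (es : Fin (S.thrArity A) → Exp S)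
  | emit (m : Bool) (s : SigRef) (e : Exp S)
  | present (s : SigRef) (P : Proc S) (A : S.Thr) (rs : Fin (S.thrArity A) → Rexp S)
  | matchSig (s₁ s₂ : SigRef) (P₁ P₂ : Proc S)
  | matchCon (u : Scrut S) (c : Cnst S) (P₁ P₂ : Proc S)
  | nu (ρ : Ty S) (P : Proc S)
  | par (P₁ P₂ : Proc S)

/-! ### Free variables -/

def SigRef.fv : SigRef → Set Var
  | .name s => {.sig s}
  | .bvar _ => ∅

def Tm.fv {S : Sgn} {a d : Bool} : Tm S a d → Set Var
  | .fvar x => {x}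
  | .bvar _ => ∅
  | .deref _ s => s.fv
  | .con _ ts => ⋃ i, (ts i).fv
  | .app _ _ ts => ⋃ i, (ts i).fv

def Proc.fv {S : Sgn} : Proc S → Set Var
  | .zero => ∅
  | .call _ es => ⋃ i, (es i).fv
  | .emit _ s e => s.fv ∪ e.fv
  | .present s P _ rs => s.fv ∪ P.fv ∪ ⋃ i, (rs i).fv
  | .matchSig s₁ s₂ P₁ P₂ => s₁.fv ∪ s₂.fv ∪ P₁.fv ∪ P₂.fv
  | .matchCon u _ P₁ P₂ => u.fv ∪ P₁.fv ∪ P₂.fv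
  | .nu _ P => P.fv
  | .par P₁ P₂ => P₁.fv ∪ P₂.fv

/-- The free signal names of a program. -/
def Proc.fn {S : Sgn} (P : Proc S) : Set ℕ := {s | Var.sig s ∈ P.fv}

/-! ### No dangling indices -/

def SigRef.LCAt (k : ℕ) : SigRef → Prop
  | .name _ => True
  | .bvar i => i < k

def Tm.LCAt {S : Sgn} {a d : Bool} (k : ℕ) : Tm S a d → Prop
  | .fvar _ => True
  | .bvar i => i < k
  | .deref _ s => s.LCAt k
  | .con _ ts => ∀ i, (ts i).LCAt k
  | .app _ _ ts => ∀ i, (ts i).LCAt k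

def Proc.LCAt {S : Sgn} : ℕ → Proc S → Prop
  | _, .zero => True
  | k, .call _ es => ∀ i, (es i).LCAt k
  | k, .emit _ s e => s.LCAt k ∧ e.LCAt k
  | k, .present s P _ rs => s.LCAt k ∧ P.LCAt (k + 1) ∧ ∀ i, (rs i).LCAt k
  | k, .matchSig s₁ s₂ P₁ P₂ => s₁.LCAt k ∧ s₂.LCAt k ∧ P₁.LCAt k ∧ P₂.LCAt k
  | k, .matchCon u c P₁ P₂ => u.LCAt k ∧ P₁.LCAt (k + c.arity) ∧ P₂.LCAt k
  | k, .nu _ P => P.LCAt (k + 1)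
  | k, .par P₁ P₂ => P₁.LCAt k ∧ P₂.LCAt k

/-- Every index is bound: `P` is a program (up to renaming of bound variables). -/
def Proc.LC {S : Sgn} (P : Proc S) : Prop := P.LCAt 0

/-! ### Binding named variables: `xs` is replaced by the indices `k, k+1, …` -/

def SigRef.close (xs : List Var) (k : ℕ) : SigRef → SigRef
  | .name s =>
    match xs.idxOf? (Var.sig s) with
    | some i => .bvar (k + i)
    | none => .name s
  | .bvar i => .bvar i

def Tm.close {S : Sgn} {a d : Bool} (xs : List Var) (k : ℕ) : Tm S a d → Tm S a d
  | .fvar x =>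
    match xs.idxOf? x with
    | some i => .bvar (k + i)
    | none => .fvar x
  | .bvar i => .bvar i
  | .deref h s => .deref h (s.close xs k)
  | .con c ts => .con c (fun i => (ts i).close xs k)
  | .app h f ts => .app h f (fun i => (ts i).close xs k)

def Proc.closeAt {S : Sgn} (xs : List Var) : ℕ → Proc S → Proc S
  | _, .zero => .zero
  | k, .call A es => .call A (fun i => (es i).close xs k)
  | k, .emit m s e => .emit m (s.close xs k) (e.close xs k)
  | k, .present s P A rs =>
    .present (s.close xs k) (P.closeAt xs (k + 1)) A (fun i => (rs i).close xs k)
  | k, .matchSig s₁ s₂ P₁ P₂ =>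
    .matchSig (s₁.close xs k) (s₂.close xs k) (P₁.closeAt xs k) (P₂.closeAt xs k)
  | k, .matchCon u c P₁ P₂ =>
    .matchCon (u.close xs k) c (P₁.closeAt xs (k + c.arity)) (P₂.closeAt xs k)
  | k, .nu ρ P => .nu ρ (P.closeAt xs (k + 1))
  | k, .par P₁ P₂ => .par (P₁.closeAt xs k) (P₂.closeAt xs k)

/-- The body obtained from `P` by binding the variables `xs`. For `P` without dangling indices,
`.nu ρ (P.close [.sig s])` is `ν s : ρ. P`, `.present s (P.close [x]) A rs` is `s(x).P, A(rs)`. -/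
def Proc.close {S : Sgn} (xs : List Var) (P : Proc S) : Proc S := P.closeAt xs 0

/-- `ν s₁ : ρ₁ … ν sₙ : ρₙ. P`. -/
def Proc.news {S : Sgn} : List (ℕ × Ty S) → Proc S → Proc S
  | [], P => P
  | (s, ρ) :: l, P => .nu ρ ((Proc.news l P).close [.sig s])

/-! ### Substitution of values for free variables -/

/-- A simultaneous substitution: it maps signal names to signal names and some of the other
variables to values. -/
structure Sub (S : Sgn) where
  sg : ℕ → ℕ
  vr : ℕ → Option (Val S)

/-- `θ = [v₁/x₁, …, vₙ/xₙ]`. -/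
def Sub.Binds {S : Sgn} (θ : Sub S) {n : ℕ} (xs : Fin n → Var) (vs : Fin n → Val S) : Prop :=
  (∀ i s, xs i = .sig s → vs i = .sig (θ.sg s)) ∧
    (∀ i x, xs i = .var x → θ.vr x = some (vs i)) ∧
    (∀ s, (∀ i, xs i ≠ .sig s) → θ.sg s = s) ∧
    (∀ x, (∀ i, xs i ≠ .var x) → θ.vr x = none)

def SigRef.subst {S : Sgn} (θ : Sub S) : SigRef → SigRef
  | .name s => .name (θ.sg s)
  | .bvar i => .bvar i

def Tm.subst {S : Sgn} {a d : Bool} (θ : Sub S) : Tm S a d → Tm S a d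
  | .fvar (.sig s) => .fvar (.sig (θ.sg s))
  | .fvar (.var x) => ((θ.vr x).map Val.toTm).getD (.fvar (.var x))
  | .bvar i => .bvar i
  | .deref h s => .deref h (s.subst θ)
  | .con c ts => .con c (fun i => (ts i).subst θ)
  | .app h f ts => .app h f (fun i => (ts i).subst θ)

def Proc.subst {S : Sgn} (θ : Sub S) : Proc S → Proc S
  | .zero => .zero
  | .call A es => .call A (fun i => (es i).subst θ)
  | .emit m s e => .emit m (s.subst θ) (e.subst θ)
  | .present s P A rs => .present (s.subst θ) (P.subst θ) A (fun i => (rs i).subst θ)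
  | .matchSig s₁ s₂ P₁ P₂ => .matchSig (s₁.subst θ) (s₂.subst θ) (P₁.subst θ) (P₂.subst θ)
  | .matchCon u c P₁ P₂ => .matchCon (u.subst θ) c (P₁.subst θ) (P₂.subst θ)
  | .nu ρ P => .nu ρ (P.subst θ)
  | .par P₁ P₂ => .par (P₁.subst θ) (P₂.subst θ)

/-! ### End of the instant -/

/-- `V(r)`: each `!s` is replaced by the list `V(s)` (a bound `!s` does not occur in the
continuation of a program). -/
def Tm.eoi {S : Sgn} {a : Bool} (V : ℕ → List (Val S)) : Tm S a true → Tm S a false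
  | .fvar x => .fvar x
  | .bvar i => .bvar i
  | .deref _ (.name s) => (Val.ofList (V s)).toTm
  | .deref _ (.bvar i) => .bvar i
  | .con c ts => .con c (fun i => (ts i).eoi V)
  | .app h f ts => .app h f (fun i => (ts i).eoi V)

/-- `V(A(r₁, …, rₙ))`. -/
def eoiCall {S : Sgn} (V : ℕ → List (Val S)) (A : S.Thr) (rs : Fin (S.thrArity A) → Rexp S) :
    Proc S :=
  .call A (fun i => (rs i).eoi V)

/-- `V ⊩ E` : for every signal `s`, the list `V(s)` enumerates without repetition
the finite set `E(s)`. -/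
def Represents {S : Sgn} (V : ℕ → List (Val S)) (E : ℕ → Finset (Val S)) : Prop :=
  ∀ s, (V s).Nodup ∧ ∀ v, v ∈ V s ↔ v ∈ E s

/-- The parallel composition of the emissions of `v` on `s`, for `(s, v)` in the list. -/
def emissions {S : Sgn} : List (ℕ × Val S) → Proc S
  | [] => .zero
  | (s, v) :: l => .par (.emit false (.name s) v.toTm) (emissions l)

/-- `P` is a program `P_V`: the parallel composition, in some order, of the emissions of `v` on `s`
for all `s` and all `v` in `V(s)`. -/
def IsPV {S : Sgn} (V : ℕ → List (Val S)) (P : Proc S) : Prop :=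
  ∃ l : List (ℕ × Val S), l.Nodup ∧ (∀ s v, (s, v) ∈ l ↔ v ∈ V s) ∧ P = emissions l

/-! ## Declarations and typing -/

/-- The declarations of a calculus: types `(κ₁, …, κₙ) → κ` of the function symbols and their
evaluation relation, types `(σ₁, …, σₙ)` of the thread identifiers and their defining equations
`A(x₁, …, xₙ) = P`. -/
structure Decl (S : Sgn) where
  funArg : (f : S.Fun) → Fin (S.funArity f) → Ty S
  funRes : S.Fun → Ty S
  FEval : (f : S.Fun) → (Fin (S.funArity f) → Val S) → Val S → Prop
  thrArg : (A : S.Thr) → Fin (S.thrArity A) → Ty S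
  params : (A : S.Thr) → Fin (S.thrArity A) → Var
  body : S.Thr → Proc S

variable {S : Sgn}

/-- `Γ ⊢ e : ρ`. -/
inductive HasTy (D : Decl S) {a : Bool} : Ctx S → Tm S a false → Ty S → Prop
  | var {Γ : Ctx S} {x : Var} {ρ ρ' : Ty S} :
      Γ.lookup x = some ρ → Ty.Ge ρ ρ' → HasTy D Γ (.fvar x) ρ'
  | con {Γ₀ Γ : Ctx S} {c : Cnst S} {Γs : Fin c.arity → Ctx S} {ts : Fin c.arity → Tm S a false}
      {σs : Fin c.arity → Ty S} {σ : Ty S} :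
      (∀ i, HasTy D (Γs i) (ts i) (σs i)) → ConTy c σs σ →
      Ctx.Sum Γ₀ (List.ofFn Γs) Γ → HasTy D Γ (.con c ts) σ
  | app {Γ₀ Γ : Ctx S} {h : a = true} {f : S.Fun} {Γs : Fin (S.funArity f) → Ctx S}
      {ts : Fin (S.funArity f) → Tm S a false} :
      (∀ i, HasTy D (Γs i) (ts i) (D.funArg f i)) →
      Ctx.Sum Γ₀ (List.ofFn Γs) Γ → HasTy D Γ (.app h f ts) (D.funRes f)

/-- `Γ ⊢ [r] : ρ`. -/
inductive HasTyB (D : Decl S) : Ctx S → Rexp S → Ty S → Prop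
  | varC {Γ : Ctx S} {x : Var} {ρ : Ty S} :
      Γ.lookup x = some ρ → ¬ ρ.IsSig → HasTyB D Γ (.fvar x) ρ
  | varSig {Γ : Ctx S} {s : ℕ} {u u' : Usage} {σ : Ty S} :
      Γ.lookup (.sig s) = some (.sig u σ) → Usage.Ge u.shift u' →
      HasTyB D Γ (.fvar (.sig s)) (.sig u' σ)
  | con {Γ₀ Γ : Ctx S} {c : Cnst S} {Γs : Fin c.arity → Ctx S} {rs : Fin c.arity → Rexp S}
      {σs : Fin c.arity → Ty S} {σ : Ty S} :
      (∀ i, HasTyB D (Γs i) (rs i) (σs i)) → ConTy c σs σ →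
      Ctx.Sum Γ₀ (List.ofFn Γs) Γ → HasTyB D Γ (.con c rs) σ
  | app {Γ₀ Γ : Ctx S} {f : S.Fun} {Γs : Fin (S.funArity f) → Ctx S}
      {rs : Fin (S.funArity f) → Rexp S} :
      (∀ i, HasTyB D (Γs i) (rs i) (D.funArg f i)) →
      Ctx.Sum Γ₀ (List.ofFn Γs) Γ → HasTyB D Γ (.app rfl f rs) (D.funRes f)
  | derefSet {Γ : Ctx S} {s : ℕ} {u : Usage} {σ : Ty S} {x : Mult} :
      Γ.lookup (.sig s) = some (.sig u σ) →
      ((U3.Ge u.hd ⟨.inf, .zero, .inf⟩ ∧ x = .inf) ∨ (U3.Ge u.hd ⟨.inf, .zero, .one⟩ ∧ x = .one)) →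
      HasTyB D Γ (.deref rfl (.name s)) (.set x σ)
  | derefList {Γ : Ctx S} {s : ℕ} {u : Usage} {σ : Ty S} {x : Mult} :
      Γ.lookup (.sig s) = some (.sig u σ) →
      ((U3.Ge u.hd ⟨.zero, .inf, .inf⟩ ∧ x = .inf) ∨
        (U3.Ge u.hd ⟨.zero, .zero, .one⟩ ∧ x = .one)) →
      HasTyB D Γ (.deref rfl (.name s)) (.list x σ)

/-- `Γ ⊢ [A(r₁, …, rₙ)]`. -/
def TypedCont (D : Decl S) (Γ : Ctx S) (A : S.Thr) (rs : Fin (S.thrArity A) → Rexp S) : Prop :=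
  ∃ (Γ₀ : Ctx S) (Γs : Fin (S.thrArity A) → Ctx S),
    (∀ i, HasTyB D (Γs i) (rs i) (D.thrArg A i)) ∧ Ctx.Sum Γ₀ (List.ofFn Γs) Γ

/-- `Γ ⊢ P`. -/
inductive Typed (D : Decl S) : Ctx S → Proc S → Prop
  | zero {Γ : Ctx S} : Typed D Γ .zero
  | out {Γ₁ Γ₂ Γ : Ctx S} {s : ℕ} {e : Exp S} {u : Usage} {σ : Ty S} :
      HasTy D Γ₁ (a := true) (.fvar (.sig s)) (.sig u σ) → u.hd.c1 ≠ .zero → HasTy D Γ₂ e σ →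
      Ctx.Add Γ₁ Γ₂ Γ → Typed D Γ (.emit false (.name s) e)
  | outMarked {Γ : Ctx S} {s : ℕ} {e : Exp S} {u : Usage} {σ : Ty S} :
      HasTy D Γ (a := true) (.fvar (.sig s)) (.sig u σ) → u.hd = ⟨.one, .one, .zero⟩ →
      Typed D Γ (.emit true (.name s) e)
  | nu {Γ Γ' : Ctx S} {s : ℕ} {u : Usage} {σ : Ty S} {P : Proc S} :
      P.LC → Ctx.Ext Γ ![.sig s] ![.sig u σ] Γ' → Typed D Γ' P →
      Typed D Γ (.nu (.sig u σ) (P.close [.sig s]))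
  | inp {Γ₁ Γ₂ Γ₂' Γ : Ctx S} {s : ℕ} {u : Usage} {σ : Ty S} {x : Var} {P : Proc S} {A : S.Thr}
      {rs : Fin (S.thrArity A) → Rexp S} :
      HasTy D Γ₁ (a := true) (.fvar (.sig s)) (.sig u σ) → u.hd.c2 ≠ .zero →
      P.LC → Ctx.Ext Γ₂ ![x] ![σ] Γ₂' → Typed D Γ₂' P →
      Ctx.Add Γ₁ Γ₂ Γ → TypedCont D Γ A rs →
      Typed D Γ (.present (.name s) (P.close [x]) A rs)
  | matchSig {Γ : Ctx S} {s₁ s₂ : ℕ} {P₁ P₂ : Proc S} :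
      Γ.lookup (.sig s₁) ≠ none → Γ.lookup (.sig s₂) ≠ none → Typed D Γ P₁ → Typed D Γ P₂ →
      Typed D Γ (.matchSig (.name s₁) (.name s₂) P₁ P₂)
  | matchCon {Γ₁ Γ₂ Γ₂' Γ : Ctx S} {u : Scrut S} {c : Cnst S} {σs : Fin c.arity → Ty S} {σ : Ty S}
      {xs : Fin c.arity → Var} {P₁ P₂ : Proc S} :
      ConTy c σs σ → HasTy D Γ₁ u σ → P₁.LC → Ctx.Ext Γ₂ xs σs Γ₂' → Typed D Γ₂' P₁ →
      Ctx.Add Γ₁ Γ₂ Γ → Typed D Γ P₂ →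
      Typed D Γ (.matchCon u c (P₁.close (List.ofFn xs)) P₂)
  | par {Γ₁ Γ₂ Γ : Ctx S} {P₁ P₂ : Proc S} :
      Typed D Γ₁ P₁ → Typed D Γ₂ P₂ → Ctx.Add Γ₁ Γ₂ Γ → Typed D Γ (.par P₁ P₂)
  | call {Γ₀ Γ : Ctx S} {A : S.Thr} {Γs : Fin (S.thrArity A) → Ctx S}
      {es : Fin (S.thrArity A) → Exp S} :
      (∀ i, HasTy D (Γs i) (es i) (D.thrArg A i)) →
      Ctx.Sum Γ₀ (List.ofFn Γs) Γ → Typed D Γ (.call A es)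

/-! ## Labelled transition system and bisimulation -/

/-- `e ⇓ v`. -/
inductive Eval (D : Decl S) {a : Bool} : Tm S a false → Val S → Prop
  | sig (s : ℕ) : Eval D (.fvar (.sig s)) (.sig s)
  | con {c : Cnst S} {ts : Fin c.arity → Tm S a false} {vs : Fin c.arity → Val S} :
      (∀ i, Eval D (ts i) (vs i)) → Eval D (.con c ts) (.con c vs)
  | app {h : a = true} {f : S.Fun} {ts : Fin (S.funArity f) → Tm S a false}
      {vs : Fin (S.funArity f) → Val S} {v : Val S} :
      (∀ i, Eval D (ts i) (vs i)) → D.FEval f vs v → Eval D (.app h f ts) v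

/-- Nested actions `τ`, `(ν t⃗ : ρ⃗) s̄v`, `s?v`. -/
inductive Nest (S : Sgn) : Type
  | tau
  | out (ts : List (ℕ × Ty S)) (s : ℕ) (v : Val S)
  | recv (s : ℕ) (v : Val S)

/-- Actions: nested ones, inputs `sv`, `N`, and `(E, V)`. -/
inductive Act (S : Sgn) : Type
  | nest (μ : Nest S)
  | inp (s : ℕ) (v : Val S)
  | next
  | eoi (E : ℕ → Finset (Val S)) (V : ℕ → List (Val S))

/-- The bound names of a nested action. -/
def Nest.bn : Nest S → Set ℕ
  | .out ts _ _ => {t | t ∈ ts.map Prod.fst}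
  | _ => ∅

/-- The names of a nested action. -/
def Nest.names : Nest S → Set ℕ
  | .tau => ∅
  | .out ts s v => {t | t ∈ ts.map Prod.fst} ∪ {s} ∪ v.fn
  | .recv s v => {s} ∪ v.fn

/-- The relevant actions `τ`, `(ν t⃗ : ρ⃗) s̄v`, `sv`, `N`. -/
def Act.Relevant : Act S → Prop
  | .nest (.recv _ _) => False
  | .eoi _ _ => False
  | _ => True

/-- The bound names of a relevant action. -/
def Act.bn : Act S → Set ℕ
  | .nest μ => μ.bn
  | _ => ∅

/-- `P ≽ Q` : name generations are lifted. -/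
inductive LiftsTo : Proc S → Proc S → Prop
  | refl (P : Proc S) : LiftsTo P P
  | trans {P Q R : Proc S} : LiftsTo P Q → LiftsTo Q R → LiftsTo P R
  | left {s : ℕ} {ρ : Ty S} {P Q : Proc S} : P.LC → Q.LC → s ∉ Q.fn →
      LiftsTo (.par (.nu ρ (P.close [.sig s])) Q) (.nu ρ ((Proc.par P Q).close [.sig s]))
  | right {s : ℕ} {ρ : Ty S} {P Q : Proc S} : P.LC → Q.LC → s ∉ Q.fn →
      LiftsTo (.par Q (.nu ρ (P.close [.sig s]))) (.nu ρ ((Proc.par Q P).close [.sig s]))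
  | par {P P' Q Q' : Proc S} : LiftsTo P P' → LiftsTo Q Q' → LiftsTo (.par P Q) (.par P' Q')
  | nu {s : ℕ} {ρ : Ty S} {P P' : Proc S} : P.LC → LiftsTo P P' →
      LiftsTo (.nu ρ (P.close [.sig s])) (.nu ρ (P'.close [.sig s]))
  | present {s : SigRef} {x : Var} {P P' : Proc S} {A : S.Thr}
      {rs : Fin (S.thrArity A) → Rexp S} : P.LC → LiftsTo P P' →
      LiftsTo (.present s (P.close [x]) A rs) (.present s (P'.close [x]) A rs)
  | matchSig {s₁ s₂ : SigRef} {P P' Q Q' : Proc S} : LiftsTo P P' → LiftsTo Q Q' →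
      LiftsTo (.matchSig s₁ s₂ P Q) (.matchSig s₁ s₂ P' Q')
  | matchCon {u : Scrut S} {c : Cnst S} {xs : Fin c.arity → Var} {P P' Q Q' : Proc S} :
      Function.Injective xs → P.LC → LiftsTo P P' → LiftsTo Q Q' →
      LiftsTo (.matchCon u c (P.close (List.ofFn xs)) Q)
        (.matchCon u c (P'.close (List.ofFn xs)) Q')

open scoped Classical in
/-- The labelled transition system. -/
inductive Step (D : Decl S) : Proc S → Act S → Proc S → Prop
  | out {m : Bool} {s : ℕ} {e : Exp S} {v : Val S} : Eval D e v →
      Step D (.emit m (.name s) e) (.nest (.out [] s v)) (.emit true (.name s) e)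
  | inAux {s : ℕ} {x : Var} {P : Proc S} {A : S.Thr} {rs : Fin (S.thrArity A) → Rexp S}
      {v : Val S} {θ : Sub S} : P.LC → θ.Binds ![x] ![v] →
      Step D (.present (.name s) (P.close [x]) A rs) (.nest (.recv s v)) (P.subst θ)
  | inp {P : Proc S} (s : ℕ) (v : Val S) :
      Step D P (.inp s v) (.par P (.emit false (.name s) v.toTm))
  | call {A : S.Thr} {es : Fin (S.thrArity A) → Exp S} {vs : Fin (S.thrArity A) → Val S}
      {θ : Sub S} : (∀ i, Eval D (es i) (vs i)) → θ.Binds (D.params A) vs →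
      Step D (.call A es) (.nest .tau) ((D.body A).subst θ)
  | sigEq {s : ℕ} {P₁ P₂ : Proc S} :
      Step D (.matchSig (.name s) (.name s) P₁ P₂) (.nest .tau) P₁
  | sigNe {s₁ s₂ : ℕ} {P₁ P₂ : Proc S} : s₁ ≠ s₂ →
      Step D (.matchSig (.name s₁) (.name s₂) P₁ P₂) (.nest .tau) P₂
  | conEq {c : Cnst S} {vs : Fin c.arity → Val S} {xs : Fin c.arity → Var} {P₁ P₂ : Proc S}
      {θ : Sub S} : Function.Injective xs → P₁.LC → θ.Binds xs vs →
      Step D (.matchCon (Val.con c vs).toTm c (P₁.close (List.ofFn xs)) P₂) (.nest .tau)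
        (P₁.subst θ)
  | conNe {v : Val S} {c : Cnst S} {P₁ P₂ : Proc S} : (∀ vs, v ≠ .con c vs) →
      Step D (.matchCon v.toTm c P₁ P₂) (.nest .tau) P₂
  | compL {P₁ P₁' P₂ : Proc S} {μ : Nest S} :
      Step D P₁ (.nest μ) P₁' → Disjoint μ.bn P₂.fn →
      Step D (.par P₁ P₂) (.nest μ) (.par P₁' P₂)
  | compR {P₁ P₂ P₂' : Proc S} {μ : Nest S} :
      Step D P₂ (.nest μ) P₂' → Disjoint μ.bn P₁.fn →
      Step D (.par P₁ P₂) (.nest μ) (.par P₁ P₂')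
  | synchL {P₁ P₁' P₂ P₂' : Proc S} {ts : List (ℕ × Ty S)} {s : ℕ} {v : Val S} :
      Step D P₁ (.nest (.out ts s v)) P₁' → Step D P₂ (.nest (.recv s v)) P₂' →
      Disjoint (Nest.out ts s v).bn P₂.fn →
      Step D (.par P₁ P₂) (.nest .tau) (Proc.news ts (.par P₁' P₂'))
  | synchR {P₁ P₁' P₂ P₂' : Proc S} {ts : List (ℕ × Ty S)} {s : ℕ} {v : Val S} :
      Step D P₁ (.nest (.recv s v)) P₁' → Step D P₂ (.nest (.out ts s v)) P₂' →
      Disjoint (Nest.out ts s v).bn P₁.fn →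
      Step D (.par P₁ P₂) (.nest .tau) (Proc.news ts (.par P₁' P₂'))
  | nu {t : ℕ} {ρ : Ty S} {P P' : Proc S} {μ : Nest S} : P.LC →
      Step D P (.nest μ) P' → t ∉ μ.names →
      Step D (.nu ρ (P.close [.sig t])) (.nest μ) (.nu ρ (P'.close [.sig t]))
  | nuEx {t : ℕ} {ρ : Ty S} {P P' : Proc S} {ts : List (ℕ × Ty S)} {s : ℕ} {v : Val S} : P.LC →
      Step D P (.nest (.out ts s v)) P' → t ≠ s → t ∈ v.fn → t ∉ ts.map Prod.fst →
      Step D (.nu ρ (P.close [.sig t])) (.nest (.out ((t, ρ) :: ts) s v)) P'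
  | zero {V : ℕ → List (Val S)} : Step D .zero (.eoi (fun _ => ∅) V) .zero
  | reset {m : Bool} {s : ℕ} {e : Exp S} {v : Val S} {V : ℕ → List (Val S)} :
      Eval D e v → v ∈ V s →
      Step D (.emit m (.name s) e) (.eoi (fun t => if t = s then {v} else ∅) V) .zero
  | cont {s : ℕ} {P : Proc S} {A : S.Thr} {rs : Fin (S.thrArity A) → Rexp S}
      {V : ℕ → List (Val S)} : V s = [] →
      Step D (.present (.name s) P A rs) (.eoi (fun _ => ∅) V) (eoiCall V A rs)
  | par {P₁ P₁' P₂ P₂' : Proc S} {E₁ E₂ : ℕ → Finset (Val S)} {V : ℕ → List (Val S)} :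
      Step D P₁ (.eoi E₁ V) P₁' → Step D P₂ (.eoi E₂ V) P₂' →
      Step D (.par P₁ P₂) (.eoi (fun s => E₁ s ∪ E₂ s) V) (.par P₁' P₂')
  | next {P P' P'' : Proc S} {ts : List (ℕ × Ty S)} {E : ℕ → Finset (Val S)}
      {V : ℕ → List (Val S)} : P'.LC →
      LiftsTo P (Proc.news ts P') → Represents V E → Step D P' (.eoi E V) P'' →
      Step D P .next (Proc.news (ts.map (fun t => (t.1, t.2.shift))) P'')

/-- `⇒τ`. -/
def TauStar (D : Decl S) : Proc S → Proc S → Prop :=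
  Relation.ReflTransGen (fun P Q => Step D P (.nest .tau) Q)

/-- Weak transitions. -/
def WStep (D : Decl S) : Act S → Proc S → Proc S → Prop
  | .nest .tau => TauStar D
  | .next => Relation.Comp (TauStar D) (fun P Q => Step D P .next Q)
  | α => Relation.Comp (Relation.Comp (TauStar D) (fun P Q => Step D P α Q)) (TauStar D)

/-- Labelled bisimulations. -/
def IsBisim (D : Decl S) (R : Proc S → Proc S → Prop) : Prop :=
  (∀ P Q, R P Q → R Q P) ∧
    ∀ P Q α P', R P Q → α.Relevant → Step D P α P' → Disjoint α.bn Q.fn →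
      ∃ Q', WStep D α Q Q' ∧ R P' Q'

/-- `P ≈ Q` : the largest labelled bisimulation. -/
def Bisim (D : Decl S) (P Q : Proc S) : Prop := ∃ R, IsBisim D R ∧ R P Q

/-- The standing assumptions on function symbols and thread identifiers. -/
structure Decl.Ok (D : Decl S) : Prop where
  /-- Function symbols have non-affine types. -/
  funArg_K : ∀ f i, (D.funArg f i).IsK
  funRes_K : ∀ f, (D.funRes f).IsK
  /-- On values of suitable type, a function symbol has a unique result. -/
  feval_unique : ∀ (Γ : Ctx S) f vs,
    HasTy D Γ (Tm.app rfl f (fun i => (vs i).toTm) : Exp S) (D.funRes f) → ∃! v, D.FEval f vs v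
  feval_fn : ∀ f vs v, D.FEval f vs v → v.fn ⊆ ⋃ i, (vs i).fn
  /-- Function symbols respect the typing. -/
  feval_eq : ∀ f vs us v u, (∀ i, ValEq (D.funArg f i) (vs i) (us i)) →
    D.FEval f vs v → D.FEval f us u → ValEq (D.funRes f) v u
  feval_ty : ∀ (Γ : Ctx S) f vs v,
    HasTy D Γ (Tm.app rfl f (fun i => (vs i).toTm) : Exp S) (D.funRes f) → D.FEval f vs v →
    HasTy D Γ (v.toTm : Exp S) (D.funRes f)
  /-- Thread identifiers have uniform types. -/
  thrArg_uniform : ∀ A i, (D.thrArg A i).IsUniform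
  /-- Each equation `A(x₁, …, xₙ) = P` has distinct parameters, and the free variables of `P`
  are among them. -/
  params_inj : ∀ A, Function.Injective (D.params A)
  body_lc : ∀ A, (D.body A).LC
  body_fv : ∀ A, (D.body A).fv ⊆ Set.range (D.params A)
  /-- Each thread identifier respects the equivalence of values of its argument types. -/
  thr_eq : ∀ A (vs us : Fin (S.thrArity A) → Val S), (∀ i, ValEq (D.thrArg A i) (vs i) (us i)) →
    Bisim D (.call A (fun i => (vs i).toTm)) (.call A (fun i => (us i).toTm))
  /-- `x₁ : σ₁, …, xₙ : σₙ ⊢ P`. -/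
  body_ty : ∀ A, ∃ Γ, Ctx.Ext Ctx.empty (D.params A) (D.thrArg A) Γ ∧ Typed D Γ (D.body A)

end SPi

namespace SPi

/-! ## Addition of types -/

/-! Typing is accounting in a commutative monoid. Partial addition of types becomes total in `Res`,
with an absorbing `undef` and a formal zero. A context is then a function into `Res S` that is
nowhere `undef`, and a term has type `σ` in `Γ` exactly when some exact demand of it at `σ` lies
below `Γ` in the algebraic order (`HasTy.exists_dem`, `HasDem.hasTy`).

Part (1). The typing of `P_V` puts the sum of the demands of all emitted values below `Γ'`, and
since `Γ ⊕ Γ'` is defined, both contexts give a common signal the same type of values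
(`compat_of_add`). After the instant an occurrence of `!s` costs the demands of all values in
`V(s)`. If its end-of-instant component is `1`, this `1` belongs to only one summand of the context,
so the cost is paid once. If the component is `∞`, the kind is not affine preserving, the values are
non-affine and their demand is idempotent, so it can be copied. Hence what an expression may use,
its `budget`, is compatible with sums of contexts (`sum_below_budget`, `load_below_budget`), and the
extra cost altogether fits into `Γ'` (`onceLoad_add_copyLoad_below`). It also fits into `↑Γ'`,
because values on signals have uniform types, which the shift does not change.

Part (2). `V(s)` and `V'(s)` differ at most in their order. Read as sets they are equivalent.
Reading `!s` as a list forces a usage that emits at most once, so that at most one value was emitted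
and the two lists are equal (`emission_unique`, `Usage.emits_once`). Constructors and functions
propagate equivalence (`HasTyB.eoi_valEq`), and the assumption on thread identifiers makes the calls
on the resulting values bisimilar. To return to the unevaluated calls (`Bisim.of_eval`), observe
that a call beside emissions cannot end the instant before it is unfolded, and that the unfolding
depends only on the values of the arguments. A call with a free variable that is not a signal name
has no values at all; two such calls are bisimilar for the same reason (`SameEval.bisim_call`). -/

theorem L.add_comm (a b : L) : L.add a b = L.add b a := by
  cases a <;> cases b <;> rfl

theorem L.add_assoc {a b c ab abc : L} (h₁ : L.add a b = some ab) (h₂ : L.add ab c = some abc) :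
    ∃ bc, L.add b c = some bc ∧ L.add a bc = some abc := by
  cases a <;> cases b <;> cases c <;> simp_all [L.add] <;> subst h₁ <;> simp_all

/-- Keeps sums inside a kind, so that the intermediate sum in `Usage.Add.assoc` is again a usage. -/
theorem L.DerivedFrom.add {a b c m : L} (ha : a.DerivedFrom m) (hb : b.DerivedFrom m)
    (h : L.add a b = some c) : c.DerivedFrom m := by
  cases a <;> cases b <;> cases m <;> simp_all [L.add, L.DerivedFrom]

theorem L.add_eq_one {a b c : L} (h : L.add a b = some c) :
    ¬ (a = .one ∧ b = .one) ∧ (c = .one ↔ a = .one ∨ b = .one) := by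
  cases a <;> cases b <;> simp_all [L.add] <;> subst h <;> simp

theorem U3.ext {x y : U3} (h₁ : x.c1 = y.c1) (h₂ : x.c2 = y.c2) (h₃ : x.c3 = y.c3) : x = y := by
  cases x; cases y; simp_all

theorem U3.Add.unique {x y z z' : U3} (h : U3.Add x y z) (h' : U3.Add x y z') : z = z' :=
  U3.ext (Option.some.inj (h.1.symm.trans h'.1)) (Option.some.inj (h.2.1.symm.trans h'.2.1))
    (Option.some.inj (h.2.2.symm.trans h'.2.2))

theorem U3.Add.comm {x y z : U3} (h : U3.Add x y z) : U3.Add y x z :=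
  ⟨L.add_comm _ _ ▸ h.1, L.add_comm _ _ ▸ h.2.1, L.add_comm _ _ ▸ h.2.2⟩

theorem U3.Add.assoc {x y z xy xyz : U3} (h₁ : U3.Add x y xy) (h₂ : U3.Add xy z xyz) :
    ∃ yz, U3.Add y z yz ∧ U3.Add x yz xyz := by
  obtain ⟨a, ha, ha'⟩ := L.add_assoc h₁.1 h₂.1
  obtain ⟨b, hb, hb'⟩ := L.add_assoc h₁.2.1 h₂.2.1
  obtain ⟨c, hc, hc'⟩ := L.add_assoc h₁.2.2 h₂.2.2
  exact ⟨⟨a, b, c⟩, ⟨ha, hb, hc⟩, ⟨ha', hb', hc'⟩⟩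

theorem U3.DerivedFrom.add {x y z : U3} {k : Kind} (hx : x.DerivedFrom k) (hy : y.DerivedFrom k)
    (h : U3.Add x y z) : z.DerivedFrom k :=
  ⟨hx.1.add hy.1 h.1, hx.2.1.add hy.2.1 h.2.1, hx.2.2.add hy.2.2 h.2.2⟩

theorem Usage.ext {u v : Usage} (h₁ : u.kind = v.kind) (h₂ : u.hd = v.hd) (h₃ : u.tl = v.tl) :
    u = v := by
  cases u; cases v; simp_all

theorem Usage.Add.unique {u v w w' : Usage} (h : Usage.Add u v w) (h' : Usage.Add u v w') :
    w = w' :=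
  Usage.ext (h.1.symm.trans h'.1) (h.2.2.1.unique h'.2.2.1) (h.2.2.2.unique h'.2.2.2)

theorem Usage.Add.comm {u v w : Usage} (h : Usage.Add u v w) : Usage.Add v u w :=
  ⟨h.2.1, h.1, h.2.2.1.comm, h.2.2.2.comm⟩

theorem Usage.Add.assoc {u v w uv uvw : Usage} (h₁ : Usage.Add u v uv)
    (h₂ : Usage.Add uv w uvw) : ∃ vw, Usage.Add v w vw ∧ Usage.Add u vw uvw := by
  obtain ⟨k₁, k₂, hh, ht⟩ := h₁
  obtain ⟨k₃, k₄, hh', ht'⟩ := h₂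
  obtain ⟨a, ha, ha'⟩ := hh.assoc hh'
  obtain ⟨b, hb, hb'⟩ := ht.assoc ht'
  have hwv : w.kind = v.kind := k₄.trans (k₃.symm.trans k₂.symm)
  exact ⟨⟨v.kind, a, b, v.hd_derived.add (hwv ▸ w.hd_derived) ha,
      v.tl_derived.add (hwv ▸ w.tl_derived) hb⟩,
    ⟨rfl, hwv, ha, hb⟩, k₁.trans k₃, k₂.trans k₃, ha', hb'⟩

theorem Usage.Add.shift {u v w : Usage} (h : Usage.Add u v w) :
    Usage.Add u.shift v.shift w.shift :=
  ⟨h.1, h.2.1, h.2.2.2, h.2.2.2⟩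

/-- The neutral character of a kind. -/
def Kind.unit : Kind → U3
  | .k1 => ⟨.inf, .zero, .inf⟩
  | .k2 => ⟨.zero, .inf, .inf⟩
  | .k3 => ⟨.inf, .zero, .zero⟩
  | .k4 => ⟨.zero, .zero, .zero⟩
  | .k5 => ⟨.zero, .zero, .zero⟩

theorem Kind.unit_derived (k : Kind) : k.unit.DerivedFrom k := by
  cases k <;> simp [Kind.unit, U3.DerivedFrom, Kind.main, L.DerivedFrom]

theorem U3.DerivedFrom.add_unit {x : U3} {k : Kind} (h : x.DerivedFrom k) :
    U3.Add x k.unit x := by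
  obtain ⟨a, b, c⟩ := x
  obtain ⟨h₁, h₂, h₃⟩ := h
  cases k <;> cases a <;> cases b <;> cases c <;>
    simp_all [Kind.unit, Kind.main, L.DerivedFrom, U3.Add, L.add]

theorem Usage.Ge.refl (u : Usage) : Usage.Ge u u :=
  ⟨⟨u.kind, u.kind.unit, u.kind.unit, u.kind.unit_derived, u.kind.unit_derived⟩, rfl, rfl,
    u.hd_derived.add_unit, u.tl_derived.add_unit⟩

/-- Two neutral elements coincide: added to `Kind.unit`, the usage gives both itself and the unit,
at the head as well as in the tail. -/
theorem Usage.Neutral.uniform {u : Usage} (h : u.Neutral) : u.Uniform := by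
  have h' := h ⟨u.kind, u.kind.unit, u.kind.unit, u.kind.unit_derived, u.kind.unit_derived⟩ rfl
  have e₁ := u.hd_derived.add_unit.unique h'.2.2.1
  have e₂ := u.tl_derived.add_unit.unique h'.2.2.2
  exact e₁.trans e₂.symm

theorem Mult.add_iff {x y z : Mult} : Mult.Add x y z ↔ x = .inf ∧ y = .inf ∧ z = .inf := by
  cases x <;> cases y <;> cases z <;> simp [Mult.Add, Mult.toL, L.add]

theorem Mult.Ge.eq {x y : Mult} (h : Mult.Ge x y) : x = y := by
  obtain ⟨c, h⟩ := h
  cases x <;> cases y <;> cases c <;> simp_all [Mult.toL, L.add]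

theorem Mult.Ge.refl (x : Mult) : Mult.Ge x x :=
  ⟨.zero, by cases x <;> rfl⟩

namespace Ty
variable {S : Sgn}

theorem Add.unique {a b c c' : Ty S} (h : Add a b c) (h' : Add a b c') : c = c' := by
  cases h with
  | ind h => cases h' with | ind h' => rw [(Mult.add_iff.1 h).2.2, (Mult.add_iff.1 h').2.2]
  | list h => cases h' with | list h' => rw [(Mult.add_iff.1 h).2.2, (Mult.add_iff.1 h').2.2]
  | set h => cases h' with | set h' => rw [(Mult.add_iff.1 h).2.2, (Mult.add_iff.1 h').2.2]
  | sig h => cases h' with | sig h' => rw [h.unique h']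

theorem Add.comm {a b c : Ty S} (h : Add a b c) : Add b a c := by
  cases h with
  | ind h => have := Mult.add_iff.1 h; exact .ind (Mult.add_iff.2 ⟨this.2.1, this.1, this.2.2⟩)
  | list h => have := Mult.add_iff.1 h; exact .list (Mult.add_iff.2 ⟨this.2.1, this.1, this.2.2⟩)
  | set h => have := Mult.add_iff.1 h; exact .set (Mult.add_iff.2 ⟨this.2.1, this.1, this.2.2⟩)
  | sig h => exact .sig h.comm

theorem Add.assoc {a b c ab abc : Ty S} (h₁ : Add a b ab) (h₂ : Add ab c abc) :
    ∃ bc, Add b c bc ∧ Add a bc abc := by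
  cases h₁ with
  | ind h =>
    cases h₂ with
    | ind h' =>
      obtain ⟨rfl, rfl, rfl⟩ := Mult.add_iff.1 h
      obtain ⟨-, rfl, rfl⟩ := Mult.add_iff.1 h'
      exact ⟨_, .ind h, .ind h⟩
  | list h =>
    cases h₂ with
    | list h' =>
      obtain ⟨rfl, rfl, rfl⟩ := Mult.add_iff.1 h
      obtain ⟨-, rfl, rfl⟩ := Mult.add_iff.1 h'
      exact ⟨_, .list h, .list h⟩
  | set h =>
    cases h₂ with
    | set h' =>
      obtain ⟨rfl, rfl, rfl⟩ := Mult.add_iff.1 h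
      obtain ⟨-, rfl, rfl⟩ := Mult.add_iff.1 h'
      exact ⟨_, .set h, .set h⟩
  | sig h =>
    cases h₂ with
    | sig h' =>
      obtain ⟨w, hw, hw'⟩ := h.assoc h'
      exact ⟨_, .sig hw, .sig hw'⟩

theorem Add.shift {a b c : Ty S} (h : Add a b c) : Add a.shift b.shift c.shift := by
  cases h with
  | ind h => exact .ind h
  | list h => exact .list h
  | set h => exact .set h
  | sig h => exact .sig h.shift

theorem Add.isSig_iff {a b c : Ty S} (h : Add a b c) : a.IsSig ↔ c.IsSig := by
  cases h <;> exact Iff.rfl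

theorem isRho_sig {u : Usage} {σ : Ty S} :
    (Ty.sig u σ).IsRho ↔ σ.IsK ∨ (u.AffPres ∧ σ.IsL) := by
  constructor
  · rintro ((h | h) | ⟨u', σ', e, h⟩)
    · exact Or.inl h.2
    · exact h.imp (fun h => h.2.2) (fun h => ⟨h.1, h.2.2⟩)
    · cases e; exact h
  · exact fun h => Or.inr ⟨u, σ, rfl, h⟩

theorem Add.isRho {a b c : Ty S} (h : Add a b c) (hc : c.IsRho) : a.IsRho := by
  cases h with
  | ind h => obtain ⟨rfl, rfl, rfl⟩ := Mult.add_iff.1 h; exact hc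
  | list h => obtain ⟨rfl, rfl, rfl⟩ := Mult.add_iff.1 h; exact hc
  | set h => obtain ⟨rfl, rfl, rfl⟩ := Mult.add_iff.1 h; exact hc
  | sig h =>
    rw [isRho_sig] at hc ⊢
    simpa [Usage.AffPres, h.1] using hc

/-- Equality is a separate case because multiplicities have no `0`: a type of multiplicity `1` is
not the sum of itself and another type. The formal zero of `Res` removes this exception. -/
theorem ge_iff {a b : Ty S} : Ge a b ↔ a = b ∨ ∃ c, Add b c a := by
  constructor
  · intro h
    cases h with
    | ind h => exact Or.inl (by rw [h.eq])
    | list h => exact Or.inl (by rw [h.eq])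
    | set h => exact Or.inl (by rw [h.eq])
    | sig h => obtain ⟨c, hc⟩ := h; exact Or.inr ⟨_, .sig hc⟩
  · rintro (rfl | ⟨c, h⟩)
    · cases a
      · exact .ind (Mult.Ge.refl _)
      · exact .list (Mult.Ge.refl _)
      · exact .set (Mult.Ge.refl _)
      · exact .sig (Usage.Ge.refl _)
    · cases h with
      | ind h => obtain ⟨rfl, rfl, rfl⟩ := Mult.add_iff.1 h; exact .ind (Mult.Ge.refl _)
      | list h => obtain ⟨rfl, rfl, rfl⟩ := Mult.add_iff.1 h; exact .list (Mult.Ge.refl _)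
      | set h => obtain ⟨rfl, rfl, rfl⟩ := Mult.add_iff.1 h; exact .set (Mult.Ge.refl _)
      | sig h => exact .sig ⟨_, h⟩

theorem IsK.add_self {a : Ty S} (h : a.IsK) : Add a a a := by
  cases a with
  | ind C x ps => exact .ind (Mult.add_iff.2 ⟨h.1, h.1, h.1⟩)
  | list x σ => exact .list (Mult.add_iff.2 ⟨h.1, h.1, h.1⟩)
  | set x σ => exact .set (Mult.add_iff.2 ⟨h.1, h.1, h.1⟩)
  | sig u σ => exact .sig (h.1 u rfl)

theorem IsUniform.shift_eq {a : Ty S} (h : a.IsUniform) : a.shift = a := by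
  cases a with
  | sig u σ =>
    have hu : u.Uniform := by
      rcases h with h | h | h
      · exact Usage.Neutral.uniform h.1
      · exact h.2.1
      · exact h.2.1
    exact congrArg (Ty.sig · σ) (Usage.ext rfl hu.symm rfl)
  | _ => rfl

end Ty

/-! ## Resources -/

/-- The total commutative monoid generated by the partial addition of types. -/
inductive Res (S : Sgn) : Type
  | undef
  | zero
  | ty (ρ : Ty S)

namespace Res
variable {S : Sgn}

open scoped Classical in
/-- The sum of two resources, `undef` if it is not defined. -/
noncomputable def add : Res S → Res S → Res S
  | undef, _ => undef
  | zero, b => b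
  | ty _, undef => undef
  | ty ρ, zero => ty ρ
  | ty ρ, ty ρ' => if h : ∃ τ, Ty.Add ρ ρ' τ then ty h.choose else undef

noncomputable instance : Add (Res S) := ⟨add⟩
instance : Zero (Res S) := ⟨zero⟩

theorem undef_add (a : Res S) : undef + a = undef := rfl

theorem zero_add' (a : Res S) : zero + a = a := rfl

theorem add_undef (a : Res S) : a + undef = undef := by cases a <;> rfl

theorem add_zero' (a : Res S) : a + zero = a := by cases a <;> rfl

theorem ty_add_ty {ρ ρ' τ : Ty S} : ty ρ + ty ρ' = ty τ ↔ Ty.Add ρ ρ' τ := by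
  change add (ty ρ) (ty ρ') = ty τ ↔ _
  unfold add
  dsimp only
  constructor
  · intro h
    split_ifs at h with h'
    cases h
    exact h'.choose_spec
  · intro h
    have h' : ∃ τ, Ty.Add ρ ρ' τ := ⟨τ, h⟩
    rw [dif_pos h', h'.choose_spec.unique h]

theorem ty_add_ty_cases (ρ ρ' : Ty S) :
    ty ρ + ty ρ' = undef ∨ ∃ τ, ty ρ + ty ρ' = ty τ ∧ Ty.Add ρ ρ' τ := by
  by_cases h : ∃ τ, Ty.Add ρ ρ' τ
  · obtain ⟨τ, h⟩ := h
    exact Or.inr ⟨τ, ty_add_ty.2 h, h⟩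
  · left
    change add (ty ρ) (ty ρ') = _
    unfold add
    dsimp only
    rw [dif_neg h]

theorem add_comm' (a b : Res S) : a + b = b + a := by
  cases a <;> cases b <;> try rfl
  rename_i ρ ρ'
  rcases ty_add_ty_cases ρ ρ' with h | ⟨τ, h, h'⟩
  · rcases ty_add_ty_cases ρ' ρ with k | ⟨τ', k, k'⟩
    · rw [h, k]
    · rw [ty_add_ty.2 k'.comm] at h
      cases h
  · rw [h, ty_add_ty.2 h'.comm]

theorem ty_add_assoc {ρ₁ ρ₂ ρ₃ τ : Ty S} (h : ty ρ₁ + ty ρ₂ + ty ρ₃ = ty τ) :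
    ty ρ₁ + (ty ρ₂ + ty ρ₃) = ty τ := by
  rcases ty_add_ty_cases ρ₁ ρ₂ with k | ⟨τ', k, k'⟩
  · rw [k, undef_add] at h
    cases h
  · rw [k, ty_add_ty] at h
    obtain ⟨w, hw, hw'⟩ := k'.assoc h
    rw [ty_add_ty.2 hw, ty_add_ty.2 hw']

/-- Associativity of the partial sum says that the right bracketing is defined if the left one is.
Commutativity turns this around, so the two are `undef` together. -/
theorem add_assoc' (a b c : Res S) : a + b + c = a + (b + c) := by
  cases a with
  | undef => rfl
  | zero => rfl
  | ty ρ₁ =>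
    cases b with
    | undef => rfl
    | zero => rfl
    | ty ρ₂ =>
      cases c with
      | undef => simp only [add_undef]
      | zero => simp only [add_zero']
      | ty ρ₃ =>
        cases h : ty ρ₁ + ty ρ₂ + ty ρ₃ with
        | ty τ => exact (ty_add_assoc h).symm
        | zero =>
          rcases ty_add_ty_cases ρ₁ ρ₂ with k | ⟨τ', k, k'⟩
          · rw [k, undef_add] at h; cases h
          · rw [k] at h
            rcases ty_add_ty_cases τ' ρ₃ with l | ⟨_, l, _⟩ <;> rw [l] at h <;> cases h
        | undef =>
          cases h' : ty ρ₁ + (ty ρ₂ + ty ρ₃) with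
          | undef => rfl
          | ty τ =>
            rw [add_comm' (ty ρ₁), add_comm' (ty ρ₂)] at h'
            have := ty_add_assoc h'
            rw [add_comm' (ty ρ₃), add_comm' (ty ρ₂), h] at this
            exact this
          | zero =>
            rcases ty_add_ty_cases ρ₂ ρ₃ with k | ⟨τ', k, k'⟩
            · rw [k, add_undef] at h'; cases h'
            · rw [k] at h'
              rcases ty_add_ty_cases ρ₁ τ' with l | ⟨_, l, _⟩ <;> rw [l] at h' <;> cases h'

noncomputable instance : AddCommMonoid (Res S) where
  add_assoc := add_assoc'
  zero_add := zero_add'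
  add_zero := add_zero'
  add_comm := add_comm'
  nsmul := nsmulRec

/-- The resource given by an entry of a context. -/
def ofOpt : Option (Ty S) → Res S
  | none => 0
  | some ρ => ty ρ

theorem ofOpt_add {a b c : Option (Ty S)} : Ctx.OptAdd a b c ↔ ofOpt a + ofOpt b = ofOpt c := by
  constructor
  · intro h
    cases h with
    | left => exact zero_add _
    | right => exact add_zero _
    | both h => exact ty_add_ty.2 h
  · intro h
    cases a with
    | none =>
      rw [ofOpt, zero_add] at h
      cases b <;> cases c <;> cases h <;> exact .left _
    | some ρ =>
      cases b with
      | none =>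
        rw [ofOpt, ofOpt, add_zero] at h
        cases c <;> cases h
        exact .right _
      | some ρ' =>
        cases c with
        | none =>
          rcases ty_add_ty_cases ρ ρ' with l | ⟨_, l, _⟩ <;> simp only [ofOpt, l] at h <;> cases h
        | some τ => exact .both (ty_add_ty.1 h)

/-- The shift of a resource. -/
def shift : Res S → Res S
  | ty ρ => ty ρ.shift
  | a => a

theorem ofOpt_map_shift (o : Option (Ty S)) : ofOpt (o.map Ty.shift) = (ofOpt o).shift := by
  cases o <;> rfl

/-- Definedness is needed: two usages may clash in their first character only, and then their shifts
can still have a sum. -/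
theorem shift_add {a b : Res S} (h : a + b ≠ undef) : (a + b).shift = a.shift + b.shift := by
  cases a with
  | undef => exact absurd rfl h
  | zero => rfl
  | ty ρ =>
    cases b with
    | undef => exact absurd rfl h
    | zero => rfl
    | ty ρ' =>
      rcases ty_add_ty_cases ρ ρ' with l | ⟨τ, l, k⟩
      · exact absurd l h
      · rw [l]
        exact (ty_add_ty.2 k.shift).symm

end Res

/-! ## The algebraic order -/

/-- The algebraic preorder of a commutative monoid. -/
def Below {M : Type*} [AddCommMonoid M] (a b : M) : Prop := ∃ c, a + c = b

namespace Below
variable {M : Type*} [AddCommMonoid M] {a b c d : M}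

theorem refl (a : M) : Below a a := ⟨0, add_zero a⟩

theorem zero (a : M) : Below 0 a := ⟨a, zero_add a⟩

theorem trans (h : Below a b) (h' : Below b c) : Below a c := by
  obtain ⟨x, rfl⟩ := h
  obtain ⟨y, rfl⟩ := h'
  exact ⟨x + y, by rw [add_assoc]⟩

theorem add (h : Below a b) (h' : Below c d) : Below (a + c) (b + d) := by
  obtain ⟨x, rfl⟩ := h
  obtain ⟨y, rfl⟩ := h'
  exact ⟨x + y, by abel⟩

theorem left (a b : M) : Below a (a + b) := ⟨b, rfl⟩

theorem right (a b : M) : Below b (a + b) := ⟨a, add_comm _ _⟩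

theorem sum {ι : Type*} (s : Finset ι) {f g : ι → M} (h : ∀ i ∈ s, Below (f i) (g i)) :
    Below (∑ i ∈ s, f i) (∑ i ∈ s, g i) := by
  classical
  induction s using Finset.induction_on with
  | empty => exact refl _
  | insert i s hi ih =>
    rw [Finset.sum_insert hi, Finset.sum_insert hi]
    exact (h i (Finset.mem_insert_self _ _)).add
      (ih fun j hj => h j (Finset.mem_insert_of_mem hj))

theorem sum_subset {ι : Type*} {s t : Finset ι} (f : ι → M) (h : s ⊆ t) :
    Below (∑ i ∈ s, f i) (∑ i ∈ t, f i) := by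
  classical
  exact ⟨∑ i ∈ t \ s, f i, by rw [add_comm, Finset.sum_sdiff h]⟩

theorem single_le_sum {ι : Type*} {s : Finset ι} (f : ι → M) {i : ι} (h : i ∈ s) :
    Below (f i) (∑ i ∈ s, f i) := by
  simpa using sum_subset f (Finset.singleton_subset_iff.2 h)

/-- Idempotent elements are absorbed by the elements above them. -/
theorem absorb (h : Below a b) (ha : a + a = a) : a + b = b := by
  obtain ⟨x, rfl⟩ := h
  rw [← add_assoc, ha]

end Below

theorem add_self_sum {M ι : Type*} [AddCommMonoid M] (s : Finset ι) (f : ι → M)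
    (h : ∀ i ∈ s, f i + f i = f i) : ∑ i ∈ s, f i + ∑ i ∈ s, f i = ∑ i ∈ s, f i := by
  rw [← Finset.sum_add_distrib]
  exact Finset.sum_congr rfl h

/-- The extra summand covers the empty sum, which is `0` and not `g`. -/
theorem sum_const_add_of_idem {M ι : Type*} [AddCommMonoid M] (s : Finset ι) {g : M}
    (h : g + g = g) : ∑ _i ∈ s, g + g = g := by
  classical
  induction s using Finset.induction_on with
  | empty => simp
  | insert i s hi ih => rw [Finset.sum_insert hi, add_assoc, ih, h]

/-! ## Contexts as resources -/

namespace Ctx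
variable {S : Sgn}

/-- The resources of a context. -/
def toRes (Γ : Ctx S) : Var → Res S := fun x => Res.ofOpt (Γ.lookup x)

theorem add_iff {Γ₁ Γ₂ Γ : Ctx S} : Add Γ₁ Γ₂ Γ ↔ Γ₁.toRes + Γ₂.toRes = Γ.toRes := by
  rw [funext_iff]
  exact forall_congr' fun x => Res.ofOpt_add

theorem toRes_ne_undef (Γ : Ctx S) (x : Var) : Γ.toRes x ≠ .undef := by
  unfold toRes
  cases Γ.lookup x <;> intro h <;> cases h

theorem toRes_eq_ty {Γ : Ctx S} {x : Var} {ρ : Ty S} :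
    Γ.toRes x = .ty ρ ↔ Γ.lookup x = some ρ := by
  unfold toRes
  constructor
  · intro h
    cases e : Γ.lookup x <;> rw [e] at h <;> cases h
    rfl
  · intro h
    rw [h]
    rfl

theorem shift_toRes (Γ : Ctx S) : Γ.shift.toRes = fun x => (Γ.toRes x).shift :=
  funext fun x => Res.ofOpt_map_shift (Γ.lookup x)

theorem OptAdd.shift {a b c : Option (Ty S)} (h : OptAdd a b c) :
    OptAdd (a.map Ty.shift) (b.map Ty.shift) (c.map Ty.shift) := by
  cases h with
  | left => exact .left _
  | right => exact .right _
  | both h => exact .both h.shift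

theorem Add.shift {Γ₁ Γ₂ Γ : Ctx S} (h : Add Γ₁ Γ₂ Γ) : Add Γ₁.shift Γ₂.shift Γ.shift :=
  fun x => (h x).shift

/-- Every part of a context is a context. -/
theorem exists_of_below {Γ : Ctx S} {d : Var → Res S} (h : Below d Γ.toRes) :
    ∃ Δ : Ctx S, Δ.toRes = d := by
  obtain ⟨c, hc⟩ := h
  have hx : ∀ x, d x + c x = Γ.toRes x := fun x => congrFun hc x
  have key : ∀ x, d x = 0 ∨ ∃ ρ τ, d x = .ty ρ ∧ Γ.lookup x = some τ ∧ τ.IsRho ∧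
      (ρ.IsRho) ∧ (ρ.IsSig ↔ τ.IsSig) := by
    intro x
    have hx := hx x
    cases e : d x with
    | undef => rw [e] at hx; exact absurd hx.symm (Γ.toRes_ne_undef x)
    | zero => exact Or.inl rfl
    | ty ρ =>
      right
      rw [e] at hx
      cases e' : c x with
      | undef => rw [e', Res.add_undef] at hx; exact absurd hx.symm (Γ.toRes_ne_undef x)
      | zero =>
        rw [e', Res.add_zero'] at hx
        have := toRes_eq_ty.1 hx.symm
        exact ⟨ρ, ρ, rfl, this, Γ.wf _ _ this, Γ.wf _ _ this, Iff.rfl⟩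
      | ty ρ' =>
        rw [e'] at hx
        rcases Res.ty_add_ty_cases ρ ρ' with k | ⟨τ, k, k'⟩
        · rw [k] at hx; exact absurd hx.symm (Γ.toRes_ne_undef x)
        · rw [k] at hx
          have := toRes_eq_ty.1 hx.symm
          exact ⟨ρ, τ, rfl, this, Γ.wf _ _ this, k'.isRho (Γ.wf _ _ this), k'.isSig_iff⟩
  -- Inverse of `Res.ofOpt`; `undef` is sent to `none`, but by `key` it does not occur among the `d
  -- x`.
  let g : Res S → Option (Ty S) := fun m => match m with
    | .ty ρ => some ρ
    | _ => none
  have hg : ∀ x ρ, g (d x) = some ρ → d x = .ty ρ := by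
    intro x ρ h
    cases e : d x <;> rw [e] at h <;> cases h
    rfl
  refine ⟨⟨fun x => g (d x), ?_, ?_, ?_⟩, ?_⟩
  · refine Γ.finite.subset fun x hx => ?_
    rcases key x with h | ⟨ρ, τ, -, h', -⟩
    · exact absurd (by rw [h]) hx
    · change Γ.lookup x ≠ none
      rw [h']
      exact Option.some_ne_none _
  · intro x ρ h
    have h' := hg x ρ h
    rcases key x with h | ⟨ρ, τ, h, -, -, k, -⟩
    · rw [h] at h'; cases h'
    · rw [h] at h'; cases h'; exact k
  · intro x ρ h
    have h' := hg x ρ h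
    rcases key x with h | ⟨ρ, τ, h, l, -, -, k⟩
    · rw [h] at h'; cases h'
    · rw [h] at h'; cases h'; rw [k]; exact Γ.sorted _ _ l
  · funext x
    change Res.ofOpt (g (d x)) = d x
    rcases key x with h | ⟨ρ, τ, h, -⟩ <;> rw [h] <;> rfl

/-- Stated for an arbitrary additive function of contexts, since it serves for the resources, for
those of the shift and for `onceLoad`. -/
theorem Sum.map_eq {M : Type*} [AddCommMonoid M] (φ : Ctx S → M)
    (hφ : ∀ Γ₁ Γ₂ Γ, Add Γ₁ Γ₂ Γ → φ Γ₁ + φ Γ₂ = φ Γ) {Γ₀ Γ : Ctx S} {Γs : List (Ctx S)}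
    (h : Sum Γ₀ Γs Γ) : φ Γ₀ + (Γs.map φ).sum = φ Γ := by
  induction h with
  | nil Γ => simp
  | cons h _ ih => rw [← ih, ← hφ _ _ _ h, List.map_cons, List.sum_cons, add_assoc]

theorem Sum.map_ofFn_eq {M : Type*} [AddCommMonoid M] (φ : Ctx S → M)
    (hφ : ∀ Γ₁ Γ₂ Γ, Add Γ₁ Γ₂ Γ → φ Γ₁ + φ Γ₂ = φ Γ) {n : ℕ} {Γ₀ Γ : Ctx S}
    {Γs : Fin n → Ctx S} (h : Sum Γ₀ (List.ofFn Γs) Γ) : φ Γ₀ + ∑ i, φ (Γs i) = φ Γ := by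
  have := h.map_eq φ hφ
  rwa [List.map_ofFn, List.sum_ofFn] at this

/-- The partial sums lie below `Γ`, hence are contexts themselves. -/
theorem sum_of_toRes {Γ₀ Γ : Ctx S} {Γs : List (Ctx S)}
    (h : Γ₀.toRes + (Γs.map toRes).sum = Γ.toRes) : Sum Γ₀ Γs Γ := by
  induction Γs generalizing Γ₀ with
  | nil =>
    simp only [List.map_nil, List.sum_nil, add_zero] at h
    have : Γ₀ = Γ := by
      obtain ⟨l, _, _, _⟩ := Γ
      obtain ⟨l₀, _, _, _⟩ := Γ₀
      have : l₀ = l := by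
        funext x
        have h := congrFun h x
        simp only [toRes] at h
        cases e : l₀ x <;> cases e' : l x <;> rw [e, e'] at h <;> cases h
        all_goals rfl
      subst this
      rfl
    exact this ▸ .nil _
  | cons Γ₁ Γs ih =>
    rw [List.map_cons, List.sum_cons, ← add_assoc] at h
    obtain ⟨Δ, hΔ⟩ := exists_of_below ⟨_, h⟩
    exact .cons (add_iff.2 hΔ.symm) (ih (hΔ ▸ h))

theorem sum_ofFn_iff {n : ℕ} {Γ₀ Γ : Ctx S} {Γs : Fin n → Ctx S} :
    Sum Γ₀ (List.ofFn Γs) Γ ↔ Γ₀.toRes + ∑ i, (Γs i).toRes = Γ.toRes := by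
  constructor
  · exact fun h => h.map_ofFn_eq toRes fun _ _ _ h => add_iff.1 h
  · intro h
    apply sum_of_toRes
    rwa [List.map_ofFn, List.sum_ofFn]

theorem Sum.add {Γ₀ Γ : Ctx S} {Γs : List (Ctx S)} (h : Sum Γ₀ Γs Γ) :
    (∃ Δ, Add Γ₀ Δ Γ) ∧ ∀ Γ₁ ∈ Γs, ∃ Δ, Add Γ₁ Δ Γ := by
  have h' : Γ₀.toRes + (Γs.map toRes).sum = Γ.toRes := h.map_eq toRes fun _ _ _ h => add_iff.1 h
  have key : ∀ Γ₁ : Ctx S, Below Γ₁.toRes Γ.toRes → ∃ Δ, Add Γ₁ Δ Γ := by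
    rintro Γ₁ ⟨c, hc⟩
    obtain ⟨Δ, hΔ⟩ := exists_of_below (d := c) ⟨_, (add_comm _ _).trans hc⟩
    exact ⟨Δ, add_iff.2 (hΔ ▸ hc)⟩
  refine ⟨key _ ⟨_, h'⟩, fun Γ₁ h₁ => key _ ?_⟩
  have : Below Γ₁.toRes (Γs.map toRes).sum := by
    obtain ⟨l, hl⟩ := List.append_of_mem h₁
    obtain ⟨l', rfl⟩ := hl
    exact ⟨(l.map toRes).sum + (l'.map toRes).sum, by
      simp only [List.map_append, List.map_cons, List.sum_append, List.sum_cons]; abel⟩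
  rw [← h']
  exact this.trans (Below.right _ _)

end Ctx

/-! ## Demands -/

section
variable {S : Sgn}

/-- The resource `ρ` at `x`, nothing elsewhere. -/
noncomputable def Res.single (x : Var) (ρ : Ty S) : Var → Res S := Pi.single x (Res.ty ρ)

/-- `HasDem D t σ d` : the term `t` has type `σ` and uses exactly the resources `d`. -/
inductive HasDem (D : Decl S) {a : Bool} : Tm S a false → Ty S → (Var → Res S) → Prop
  | var (x : Var) (ρ : Ty S) : HasDem D (.fvar x) ρ (Res.single x ρ)
  | con {c : Cnst S} {ts : Fin c.arity → Tm S a false} {σs : Fin c.arity → Ty S} {σ : Ty S}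
      {d : Fin c.arity → Var → Res S} :
      (∀ i, HasDem D (ts i) (σs i) (d i)) → ConTy c σs σ → HasDem D (.con c ts) σ (∑ i, d i)
  | app {h : a = true} {f : S.Fun} {ts : Fin (S.funArity f) → Tm S a false}
      {d : Fin (S.funArity f) → Var → Res S} :
      (∀ i, HasDem D (ts i) (D.funArg f i) (d i)) →
      HasDem D (.app h f ts) (D.funRes f) (∑ i, d i)

theorem Res.single_below_iff {x : Var} {ρ : Ty S} {Γ : Ctx S} :
    Below (Res.single x ρ) Γ.toRes ↔ ∃ ρ', Γ.lookup x = some ρ' ∧ Ty.Ge ρ' ρ := by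
  constructor
  · rintro ⟨c, hc⟩
    have h := congrFun hc x
    rw [Pi.add_apply, Res.single, Pi.single_eq_same] at h
    cases e : c x with
    | undef => rw [e, Res.add_undef] at h; exact absurd h.symm (Γ.toRes_ne_undef x)
    | zero =>
      rw [e, Res.add_zero'] at h
      exact ⟨ρ, Ctx.toRes_eq_ty.1 h.symm, Ty.ge_iff.2 (Or.inl rfl)⟩
    | ty τ =>
      rw [e] at h
      rcases Res.ty_add_ty_cases ρ τ with k | ⟨τ', k, k'⟩
      · rw [k] at h; exact absurd h.symm (Γ.toRes_ne_undef x)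
      · rw [k] at h
        exact ⟨τ', Ctx.toRes_eq_ty.1 h.symm, Ty.ge_iff.2 (Or.inr ⟨_, k'⟩)⟩
  · rintro ⟨ρ', h, h'⟩
    have key : ∃ m : Res S, .ty ρ + m = Γ.toRes x := by
      rw [Ctx.toRes_eq_ty.2 h]
      rcases Ty.ge_iff.1 h' with rfl | ⟨c, hc⟩
      · exact ⟨0, add_zero _⟩
      · exact ⟨.ty c, Res.ty_add_ty.2 hc⟩
    obtain ⟨m, hm⟩ := key
    -- The complement of the single resource: `m` at `x`, and all of `Γ` elsewhere.
    refine ⟨Function.update Γ.toRes x m, funext fun y => ?_⟩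
    rw [Pi.add_apply, Res.single]
    by_cases hy : y = x
    · subst hy
      rw [Pi.single_eq_same, Function.update_self, hm]
    · rw [Pi.single_eq_of_ne hy, Function.update_of_ne hy, zero_add]

/-- The freedom in a typing derivation, namely the order in the variable rule and the arbitrary `Γ₀`
in sums, is collected in one `Below` at the root. -/
theorem HasTy.exists_dem {D : Decl S} {a : Bool} {Γ : Ctx S} {t : Tm S a false} {σ : Ty S}
    (h : HasTy D Γ t σ) : ∃ d, HasDem D t σ d ∧ Below d Γ.toRes := by
  induction h with
  | var h h' => exact ⟨_, .var _ _, Res.single_below_iff.2 ⟨_, h, h'⟩⟩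
  | con _ hc hs ih =>
    choose d hd hb using ih
    refine ⟨_, .con hd hc, ?_⟩
    rw [← Ctx.sum_ofFn_iff.1 hs]
    exact (Below.sum _ fun i _ => hb i).trans (Below.right _ _)
  | app _ hs ih =>
    choose d hd hb using ih
    refine ⟨_, .app hd, ?_⟩
    rw [← Ctx.sum_ofFn_iff.1 hs]
    exact (Below.sum _ fun i _ => hb i).trans (Below.right _ _)

/-- A part of a context that is a sum splits off contexts for the summands. -/
theorem Ctx.exists_sum_of_below {Γ : Ctx S} {n : ℕ} {d : Fin n → Var → Res S}
    (h : Below (∑ i, d i) Γ.toRes) :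
    ∃ (Γ₀ : Ctx S) (Γs : Fin n → Ctx S), (∀ i, (Γs i).toRes = d i) ∧
      Ctx.Sum Γ₀ (List.ofFn Γs) Γ := by
  have hi : ∀ i, ∃ Δ : Ctx S, Δ.toRes = d i := fun i =>
    Ctx.exists_of_below ((Below.single_le_sum d (Finset.mem_univ i)).trans h)
  choose Γs hΓs using hi
  obtain ⟨c, hc⟩ := h
  obtain ⟨Γ₀, hΓ₀⟩ := Ctx.exists_of_below (d := c) ⟨_, (add_comm _ _).trans hc⟩
  refine ⟨Γ₀, Γs, hΓs, Ctx.sum_ofFn_iff.2 ?_⟩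
  rw [hΓ₀, Finset.sum_congr rfl fun i _ => hΓs i, add_comm, hc]

theorem HasDem.hasTy {D : Decl S} {a : Bool} {t : Tm S a false} {σ : Ty S} {d : Var → Res S}
    (h : HasDem D t σ d) {Γ : Ctx S} (hΓ : Below d Γ.toRes) : HasTy D Γ t σ := by
  induction h generalizing Γ with
  | var x ρ =>
    obtain ⟨ρ', h, h'⟩ := Res.single_below_iff.1 hΓ
    exact .var h h'
  | con _ hc ih =>
    obtain ⟨Γ₀, Γs, hs, hsum⟩ := Ctx.exists_sum_of_below hΓ
    exact .con (fun i => ih i (hs i ▸ Below.refl _)) hc hsum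
  | app _ ih =>
    obtain ⟨Γ₀, Γs, hs, hsum⟩ := Ctx.exists_sum_of_below hΓ
    exact .app (fun i => ih i (hs i ▸ Below.refl _)) hsum

/-! ### Demands that can be copied, and demands that the shift preserves -/

theorem elim_of_forall {α β : Type*} (p : β → Prop) {b : β} {f : α → β} (hb : p b)
    (hf : ∀ a, p (f a)) (o : Option α) : p (o.elim b f) := by
  cases o with
  | none => exact hb
  | some a => exact hf a

theorem ConTy.isUniform {c : Cnst S} {σs : Fin c.arity → Ty S} {σ : Ty S} (h : ConTy c σs σ) :
    σ.IsUniform ∧ ∀ i, (σs i).IsUniform := by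
  have aux : ∀ {x : Mult} {σ : Ty S}, ((x = .inf ∧ σ.IsK) ∨ (x = .one ∧ (σ.IsK ∨ σ.IsL))) →
      σ.IsUniform := by
    rintro x σ (h | h)
    · exact Or.inl h.2
    · exact h.2
  cases h with
  | ind h =>
    cases h with
    | nil h => exact ⟨h, fun i => i.elim0⟩
    | cons h => exact ⟨h, Fin.forall_fin_two.2 ⟨aux h, h⟩⟩
    | @other c x ps h =>
      refine ⟨h, fun i => elim_of_forall Ty.IsUniform h (fun j => ?_) _⟩
      rcases h with h | h
      · exact Or.inl (h.2 j)
      · exact h.2 j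
  | setNil h => exact ⟨h, fun i => i.elim0⟩
  | setCons h => exact ⟨h, Fin.forall_fin_two.2 ⟨aux h, h⟩⟩

theorem ConTy.isK {c : Cnst S} {σs : Fin c.arity → Ty S} {σ : Ty S} (h : ConTy c σs σ)
    (hσ : σ.IsK) : ∀ i, (σs i).IsK := by
  cases h with
  | ind h =>
    cases h with
    | nil h => exact fun i => i.elim0
    | cons h => exact Fin.forall_fin_two.2 ⟨hσ.2, hσ⟩
    | @other c x ps h =>
      exact fun i => elim_of_forall Ty.IsK hσ hσ.2 _
  | setNil h => exact fun i => i.elim0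
  | setCons h => exact Fin.forall_fin_two.2 ⟨hσ.2, hσ⟩

/-- Non-affinity passes from a term to all its subterms: constructors of a non-affine type have
non-affine arguments, and function symbols take only such arguments. At the leaves it makes types
idempotent. -/
theorem HasDem.add_self {D : Decl S} (hD : ∀ f i, (D.funArg f i).IsK) {a : Bool}
    {t : Tm S a false} {σ : Ty S} {d : Var → Res S} (h : HasDem D t σ d) (hσ : σ.IsK) :
    d + d = d := by
  induction h with
  | var x ρ => rw [Res.single, ← Pi.single_add, Res.ty_add_ty.2 hσ.add_self]
  | con _ hc ih => exact add_self_sum _ _ fun i _ => ih i (hc.isK hσ i)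
  | app _ ih => exact add_self_sum _ _ fun i _ => ih i (hD _ i)

/-- Resources that the shift does not change. -/
def Res.Steady (d : Var → Res S) : Prop := ∀ x, (d x).shift = d x

theorem Res.Steady.zero : Res.Steady (0 : Var → Res S) := fun _ => rfl

theorem Res.Steady.add {d d' : Var → Res S} (h : Res.Steady d) (h' : Res.Steady d') :
    Res.Steady (d + d') := by
  intro x
  by_cases k : d x + d' x = .undef
  · rw [Pi.add_apply, k]; rfl
  · rw [Pi.add_apply, Res.shift_add k, h x, h' x]

theorem Res.Steady.sum {ι : Type*} (s : Finset ι) {d : ι → Var → Res S}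
    (h : ∀ i ∈ s, Res.Steady (d i)) : Res.Steady (∑ i ∈ s, d i) :=
  Finset.sum_induction d Res.Steady (fun _ _ => Res.Steady.add) Res.Steady.zero h

theorem Res.Steady.below_shift {d : Var → Res S} (h : Res.Steady d) {Γ : Ctx S}
    (hd : Below d Γ.toRes) : Below d Γ.shift.toRes := by
  obtain ⟨c, hc⟩ := hd
  -- The complement is shifted along; the sums are defined because they are entries of `Γ`.
  refine ⟨fun x => (c x).shift, funext fun x => ?_⟩
  rw [Ctx.shift_toRes]
  change d x + (c x).shift = (Γ.toRes x).shift
  rw [← hc, Pi.add_apply, Res.shift_add, h x]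
  rw [← Pi.add_apply, hc]
  exact Γ.toRes_ne_undef x

theorem HasDem.steady {D : Decl S} (hD : ∀ f i, (D.funArg f i).IsK) {a : Bool}
    {t : Tm S a false} {σ : Ty S} {d : Var → Res S} (h : HasDem D t σ d) (hσ : σ.IsUniform) :
    Res.Steady d := by
  induction h with
  | var x ρ =>
    intro y
    by_cases hy : y = x
    · subst hy
      rw [Res.single, Pi.single_eq_same, Res.shift, hσ.shift_eq]
    · rw [Res.single, Pi.single_eq_of_ne hy]
      rfl
  | con _ hc ih => exact Res.Steady.sum _ fun i _ => ih i (hc.isUniform.2 i)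
  | app _ ih => exact Res.Steady.sum _ fun i _ => ih i (Or.inl (hD _ i))

/-- Keeping `τ` abstract, with only the typings of `nil` and `cons`, covers both list and set types.
-/
theorem HasDem.ofList {D : Decl S} {a : Bool}
    {L : List (Val S)} {σ : Ty S} {d : Val S → Var → Res S}
    (h : ∀ v ∈ L, HasDem D (v.toTm : Tm S a false) σ (d v)) {τ : Ty S}
    (hnil : ConTy .nil Fin.elim0 τ) (hcons : ConTy .cons ![σ, τ] τ) :
    HasDem D ((Val.ofList L).toTm : Tm S a false) τ (L.map d).sum := by
  induction L with
  | nil =>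
    have := HasDem.con (D := D) (a := a) (c := .nil) (ts := fun i => (Fin.elim0 i : Val S).toTm)
      (σs := Fin.elim0) (d := Fin.elim0) (fun i => i.elim0) hnil
    exact this
  | cons v L ih =>
    have ih := ih fun w hw => h w (List.mem_cons_of_mem _ hw)
    have := HasDem.con (D := D) (a := a) (c := .cons)
      (ts := fun i => (![v, Val.ofList L] i).toTm)
      (σs := ![σ, τ]) (d := ![d v, (L.map d).sum])
      (Fin.forall_fin_two.2 ⟨h v List.mem_cons_self, ih⟩) hcons
    have e : ∑ i : Fin (Cnst.arity (.cons : Cnst S)), (![d v, (L.map d).sum] : Fin 2 → _) i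
        = ((v :: L).map d).sum := by
      exact (Fin.sum_univ_two _).trans rfl
    rw [e] at this
    exact this

/-! ## Reading the emissions of an instant -/

theorem Typed.emit_inv {D : Decl S} {Γ : Ctx S} {s : ℕ} {e : Exp S}
    (h : Typed D Γ (.emit false (.name s) e)) :
    ∃ (u : Usage) (τ : Ty S) (d : Var → Res S), u.hd.c1 ≠ .zero ∧ HasDem D e τ d ∧
      Below (Res.single (.sig s) (.sig u τ) + d) Γ.toRes := by
  cases h with
  | out h₁ hu h₂ hΓ =>
    cases h₁ with
    | var hl hg =>
      obtain ⟨d, hd, hb⟩ := h₂.exists_dem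
      refine ⟨_, _, d, hu, hd, ?_⟩
      rw [← Ctx.add_iff.1 hΓ]
      exact (Res.single_below_iff.2 ⟨_, hl, hg⟩).add hb

/-- `m` is the demand, for the signal of an emission `p` of a value, of the right to emit, and
`d` the one for the value. -/
def EmissionDem (D : Decl S) (p : ℕ × Val S) (m d : Var → Res S) : Prop :=
  ∃ (u : Usage) (τ : Ty S), u.hd.c1 ≠ .zero ∧ HasDem D (p.2.toTm : Exp S) τ d ∧
    m = Res.single (.sig p.1) (.sig u τ)

/-- Since the pairs are distinct, the demands can be recorded as functions of the pair, and
extending them at the head does not disturb the tail. -/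
theorem Typed.emissions_dem {D : Decl S} {l : List (ℕ × Val S)} (hl : l.Nodup) {Γ : Ctx S}
    (h : Typed D Γ (emissions l)) :
    ∃ m d : ℕ × Val S → Var → Res S, (∀ p ∈ l, EmissionDem D p (m p) (d p)) ∧
      Below (l.map fun p => m p + d p).sum Γ.toRes := by
  classical
  induction l generalizing Γ with
  | nil => exact ⟨fun _ => 0, fun _ => 0, by simp, Below.zero _⟩
  | cons p l ih =>
    obtain ⟨s, v⟩ := p
    cases h with
    | par h₁ h₂ hΓ =>
      obtain ⟨u, τ, d, hu, hd, hb⟩ := h₁.emit_inv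
      obtain ⟨ms, ds, hs, hbs⟩ := ih hl.of_cons h₂
      have hne : ∀ p ∈ l, p ≠ (s, v) := fun p hp e => (List.nodup_cons.1 hl).1 (e ▸ hp)
      refine ⟨Function.update ms (s, v) (Res.single (.sig s) (.sig u τ)),
        Function.update ds (s, v) d, ?_, ?_⟩
      · intro p hp
        by_cases e : p = (s, v)
        · subst e
          rw [Function.update_self, Function.update_self]
          exact ⟨u, τ, hu, hd, rfl⟩
        · simp only [Function.update_of_ne e]
          exact hs p ((List.mem_cons.1 hp).resolve_left e)
      · rw [List.map_cons, List.sum_cons, ← Ctx.add_iff.1 hΓ]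
        refine Below.add ?_ ?_
        · simpa using hb
        · rw [List.map_congr_left (g := fun p => ms p + ds p)]
          · exact hbs
          · intro p hp
            simp only [Function.update_of_ne (hne p hp)]

/-! ### The cost of dereferencing signals -/

/-- The demand of the values in `V s`, given those of the values. -/
noncomputable def load (V : ℕ → List (Val S)) (d : ℕ × Val S → Var → Res S) (s : ℕ) : Var → Res S :=
  ((V s).map fun v => d (s, v)).sum

/-- A signal that is read once at the end of the instant. -/
def ReadOnce (o : Option (Ty S)) : Prop := ∃ u σ, o = some (.sig u σ) ∧ u.hd.c3 = .one

theorem ReadOnce.ty {u : Usage} {σ : Ty S} : ReadOnce (some (.sig u σ)) ↔ u.hd.c3 = .one := by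
  constructor
  · rintro ⟨u, σ, h, h'⟩
    cases h
    exact h'
  · exact fun h => ⟨u, σ, rfl, h⟩

open scoped Classical in
-- As `1 ⊕ 1` is undefined and `1` arises only from `1` and `0`, a component `1` of a sum comes from
-- exactly one summand.
theorem readOnce_add {M : Type*} [AddCommMonoid M] (m : M) {a b c : Option (Ty S)}
    (h : Ctx.OptAdd a b c) :
    ((if ReadOnce a then m else 0) + if ReadOnce b then m else 0) =
      if ReadOnce c then m else 0 := by
  have h0 : ¬ ReadOnce (none : Option (Ty S)) := by rintro ⟨_, _, h, _⟩; cases h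
  cases h with
  | left => rw [if_neg h0, zero_add]
  | right => rw [if_neg h0, add_zero]
  | both h =>
    cases h with
    | @sig u v w σ h =>
      have := L.add_eq_one h.2.2.1.2.2
      simp only [ReadOnce.ty]
      by_cases h₁ : u.hd.c3 = L.one <;> by_cases h₂ : v.hd.c3 = L.one <;> simp_all
    | _ =>
      rw [if_neg, if_neg, if_neg, add_zero] <;> (rintro ⟨_, _, h, _⟩; cases h)

open scoped Classical in
/-- The demand of the values on the signals in `B` that `Γ` reads once. -/
noncomputable def onceLoad (B : Finset ℕ) (K : ℕ → Var → Res S) (Γ : Ctx S) : Var → Res S :=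
  ∑ s ∈ B, if ReadOnce (Γ.lookup (.sig s)) then K s else 0

theorem onceLoad_add {B : Finset ℕ} {K : ℕ → Var → Res S} {Γ₁ Γ₂ Γ : Ctx S}
    (h : Ctx.Add Γ₁ Γ₂ Γ) : onceLoad B K Γ₁ + onceLoad B K Γ₂ = onceLoad B K Γ := by
  unfold onceLoad
  rw [← Finset.sum_add_distrib]
  exact Finset.sum_congr rfl fun s _ => readOnce_add _ (h _)

open scoped Classical in
/-- The part of the demand that can be copied. -/
noncomputable def copyLoad (B : Finset ℕ) (K : ℕ → Var → Res S) : Var → Res S :=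
  ∑ s ∈ B with K s + K s = K s, K s

theorem copyLoad_idem (B : Finset ℕ) (K : ℕ → Var → Res S) :
    copyLoad B K + copyLoad B K = copyLoad B K := by
  classical
  exact add_self_sum _ _ fun s hs => (Finset.mem_filter.1 hs).2

/-- A signal that is read once may also have an idempotent load, and then it is counted twice on the
left. The total absorbs the second copy. -/
theorem onceLoad_add_copyLoad_below (B : Finset ℕ) (K : ℕ → Var → Res S) (Γ : Ctx S) :
    Below (onceLoad B K Γ + copyLoad B K) (∑ s ∈ B, K s) := by
  classical
  have h : Below (copyLoad B K) (∑ s ∈ B, K s) := Below.sum_subset _ (Finset.filter_subset _ _)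
  rw [← h.absorb (copyLoad_idem B K), add_comm]
  refine (Below.refl _).add (Below.sum _ fun s _ => ?_)
  split_ifs
  · exact Below.refl _
  · exact Below.zero _

/-- Affine values travel only on signals of kind 3, 4 or 5, whose main usages have third component
`1` or `0`, never `∞`. -/
theorem Usage.isK_of_hd {u : Usage} {σ : Ty S} (h : (Ty.sig u σ).IsRho) (hu : u.hd.c3 = .inf) :
    σ.IsK := by
  refine (Ty.isRho_sig.1 h).resolve_right fun ⟨h, _⟩ => ?_
  have := u.hd_derived.2.2
  rw [hu] at this
  rcases h with h | h | h <;> rw [h] at this <;> simp [Kind.main, L.DerivedFrom] at this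

theorem U3.Ge.c3_eq {x y : U3} (h : U3.Ge x y) (hy : y.c3 ≠ .zero) : x.c3 = y.c3 := by
  obtain ⟨k, -, -, c, -, -, -, h⟩ := h
  cases e : y.c3 <;> cases e' : c.c3 <;> cases e'' : x.c3 <;> simp_all [L.add]

/-- The types that `Γ` gives to signals are those of the demands of the emitted values. -/
def Compat (D : Decl S) (V : ℕ → List (Val S)) (d : ℕ × Val S → Var → Res S) (Γ : Ctx S) :
    Prop :=
  ∀ s u τ, Γ.lookup (.sig s) = some (.sig u τ) →
    ∀ v ∈ V s, HasDem D (v.toTm : Exp S) τ (d (s, v))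

theorem Ctx.Add.lookup_sig {Γ₁ Γ₂ Γ : Ctx S} (h : Ctx.Add Γ₁ Γ₂ Γ) {x : Var} {u : Usage} {τ : Ty S}
    (h₁ : Γ₁.lookup x = some (.sig u τ)) :
    ∃ v, Γ.lookup x = some (.sig v τ) ∧ v.kind = u.kind ∧
      ∀ w τ', Γ₂.lookup x = some (.sig w τ') → τ' = τ ∧ w.kind = u.kind := by
  have := h x
  rw [h₁] at this
  generalize Γ.lookup x = c at this
  generalize Γ₂.lookup x = b at this
  cases this with
  | right => exact ⟨u, rfl, rfl, fun _ _ h => nomatch h⟩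
  | both h =>
    cases h with
    | sig h =>
      refine ⟨_, rfl, h.1.symm, fun _ _ e => ?_⟩
      cases e
      exact ⟨rfl, h.2.1.trans h.1.symm⟩

theorem Compat.summand {D : Decl S} {V : ℕ → List (Val S)} {d : ℕ × Val S → Var → Res S}
    {Γ Γ₁ Γ₂ : Ctx S} (h : Compat D V d Γ) (hΓ : Ctx.Add Γ₁ Γ₂ Γ) : Compat D V d Γ₁ := by
  intro s u τ hs
  obtain ⟨v, hv, -⟩ := hΓ.lookup_sig hs
  exact h s v τ hv

theorem Ctx.Sum.ofFn_add {Γ₀ Γ : Ctx S} {n : ℕ} {Γs : Fin n → Ctx S}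
    (h : Ctx.Sum Γ₀ (List.ofFn Γs) Γ) (i : Fin n) : ∃ Δ, Ctx.Add (Γs i) Δ Γ :=
  h.add.2 _ (List.mem_ofFn.2 ⟨i, rfl⟩)

/-- What an expression typed in `Γ` may use at the end of the instant. -/
noncomputable def budget (B : Finset ℕ) (K : ℕ → Var → Res S) (Γ : Ctx S) : Var → Res S :=
  Γ.shift.toRes + (onceLoad B K Γ + copyLoad B K)

/-- The three parts of the budget behave differently: the shifted context and `onceLoad` are
additive, whereas `copyLoad` is idempotent and may be granted to every summand. -/
theorem sum_below_budget {B : Finset ℕ} {K : ℕ → Var → Res S} {Γ₀ Γ : Ctx S} {n : ℕ}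
    {Γs : Fin n → Ctx S} (h : Ctx.Sum Γ₀ (List.ofFn Γs) Γ) {d : Fin n → Var → Res S}
    (hd : ∀ i, Below (d i) (budget B K (Γs i))) : Below (∑ i, d i) (budget B K Γ) := by
  refine (Below.sum _ fun i _ => hd i).trans ?_
  unfold budget
  rw [Finset.sum_add_distrib, Finset.sum_add_distrib]
  refine Below.add ?_ (Below.add ?_ ?_)
  · rw [← h.map_ofFn_eq (fun Γ => Γ.shift.toRes) fun _ _ _ h => Ctx.add_iff.1 h.shift]
    exact Below.right _ _
  · rw [← h.map_ofFn_eq (onceLoad B K) fun _ _ _ h => onceLoad_add h]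
    exact Below.right _ _
  · exact ⟨_, sum_const_add_of_idem _ (copyLoad_idem B K)⟩

/-- A component `∞` makes the values non-affine, so the load belongs to `copyLoad`; a component `1`
places it in `onceLoad`. The second conclusion makes the type of the list or set that is read well
formed. -/
theorem load_below_budget {D : Decl S} (hD : ∀ f i, (D.funArg f i).IsK) {V : ℕ → List (Val S)}
    {d : ℕ × Val S → Var → Res S} {B : Finset ℕ} (hB : ∀ s, s ∉ B → V s = []) {Γ : Ctx S}
    (hC : Compat D V d Γ) {s : ℕ} {u : Usage} {σ : Ty S}
    (hs : Γ.lookup (.sig s) = some (.sig u σ)) {x : Mult}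
    (hx : (u.hd.c3 = .inf ∧ x = .inf) ∨ (u.hd.c3 = .one ∧ x = .one)) :
    Below (load V d s) (budget B (load V d) Γ) ∧
      ((x = .inf ∧ σ.IsK) ∨ (x = .one ∧ (σ.IsK ∨ σ.IsL))) := by
  classical
  have hρ := Γ.wf _ _ hs
  have hpart : s ∉ B → Below (load V d s) (budget B (load V d) Γ) := by
    intro h
    unfold load
    rw [hB s h]
    exact Below.zero _
  rcases hx with ⟨h3, rfl⟩ | ⟨h3, rfl⟩
  · have hK := Usage.isK_of_hd hρ h3
    refine ⟨?_, Or.inl ⟨rfl, hK⟩⟩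
    by_cases hsB : s ∈ B
    · refine Below.trans ?_ ((Below.right _ _).trans (Below.right _ _))
      refine Below.single_le_sum (load V d) (Finset.mem_filter.2 ⟨hsB, ?_⟩)
      unfold load
      -- Each emitted value has an idempotent demand, hence so has their sum.
      have := fun v hv => (hC s u σ hs v hv).add_self hD hK
      clear hpart
      generalize V s = L at this
      induction L with
      | nil => exact add_zero _
      | cons v L ih =>
        rw [List.map_cons, List.sum_cons, add_add_add_comm, this v List.mem_cons_self,
          ih fun w hw => this w (List.mem_cons_of_mem _ hw)]
    · exact hpart hsB
  · refine ⟨?_, Or.inr ⟨rfl, (Ty.isRho_sig.1 hρ).imp_right fun h => h.2⟩⟩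
    by_cases hsB : s ∈ B
    · refine Below.trans ?_ ((Below.left _ _).trans (Below.right _ _))
      have := Below.single_le_sum
        (fun s => if ReadOnce (Γ.lookup (.sig s)) then load V d s else 0) hsB
      rwa [if_pos (by rw [hs]; exact ReadOnce.ty.2 h3)] at this
    · exact hpart hsB

/-- Variables are paid by the shifted context, dereferenced signals by the loads. The induction goes
through because budgets add up along sums of contexts. -/
theorem HasTyB.exists_dem {D : Decl S} (hD : ∀ f i, (D.funArg f i).IsK) {V : ℕ → List (Val S)}
    {d : ℕ × Val S → Var → Res S} {B : Finset ℕ} (hB : ∀ s, s ∉ B → V s = [])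
    {Γ : Ctx S} {r : Rexp S} {σ : Ty S} (h : HasTyB D Γ r σ) (hC : Compat D V d Γ) :
    ∃ m, HasDem D (r.eoi V) σ m ∧ Below m (budget B (load V d) Γ) := by
  induction h with
  | @varC Γ x ρ h hρ =>
    have hl : Γ.shift.lookup x = some ρ := by
      change (Γ.lookup x).map Ty.shift = _
      rw [h, Option.map_some]
      cases ρ with
      | sig => exact absurd trivial hρ
      | _ => rfl
    exact ⟨_, .var _ _, (Res.single_below_iff.2 ⟨_, hl, Ty.ge_iff.2 (Or.inl rfl)⟩).trans
      (Below.left _ _)⟩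
  | @varSig Γ s u u' σ h hu =>
    have hl : Γ.shift.lookup (.sig s) = some (.sig u.shift σ) := by
      change (Γ.lookup _).map Ty.shift = _
      rw [h]
      rfl
    exact ⟨_, .var _ _, (Res.single_below_iff.2 ⟨_, hl, .sig hu⟩).trans (Below.left _ _)⟩
  | con _ hc hs ih =>
    choose m hm hb using fun i => ih i (hC.summand (hs.ofFn_add i).choose_spec)
    exact ⟨_, .con hm hc, sum_below_budget hs hb⟩
  | app _ hs ih =>
    choose m hm hb using fun i => ih i (hC.summand (hs.ofFn_add i).choose_spec)
    exact ⟨_, .app hm, sum_below_budget hs hb⟩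
  | @derefSet Γ s u σ x h hx =>
    obtain ⟨hb, hu⟩ := load_below_budget hD hB hC h (x := x)
      (hx.imp (And.imp_left fun h => h.c3_eq (by simp)) (And.imp_left fun h => h.c3_eq (by simp)))
    have hu : (Ty.set x σ).IsUniform := hu.imp id id
    exact ⟨_, HasDem.ofList (fun v hv => hC s u σ h v hv) (.setNil hu) (.setCons hu), hb⟩
  | @derefList Γ s u σ x h hx =>
    obtain ⟨hb, hu⟩ := load_below_budget hD hB hC h (x := x)
      (hx.imp (And.imp_left fun h => h.c3_eq (by simp)) (And.imp_left fun h => h.c3_eq (by simp)))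
    have hu : (Ty.list x σ).IsUniform := hu.imp id id
    exact ⟨_, HasDem.ofList (fun v hv => hC s u σ h v hv) (.ind (.nil hu)) (.ind (.cons hu)), hb⟩

theorem EmissionDem.lookup {D : Decl S} {p : ℕ × Val S} {m d : Var → Res S}
    (h : EmissionDem D p m d) {Γ : Ctx S} (hb : Below m Γ.toRes) :
    ∃ u τ, Γ.lookup (.sig p.1) = some (.sig u τ) ∧ HasDem D (p.2.toTm : Exp S) τ d := by
  obtain ⟨u, τ, -, hd, rfl⟩ := h
  obtain ⟨ρ, hl, hg⟩ := Res.single_below_iff.1 hb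
  cases hg with
  | sig hg => exact ⟨_, _, hl, hd⟩

theorem below_of_mem {l : List (ℕ × Val S)} (hl : l.Nodup) {r : Var → Res S}
    {f : ℕ × Val S → Var → Res S} (hb : Below (l.map f).sum r) {p : ℕ × Val S} (hp : p ∈ l) :
    Below (f p) r := by
  classical
  rw [← List.sum_toFinset _ hl] at hb
  exact (Below.single_le_sum f (List.mem_toFinset.2 hp)).trans hb

/-- A signal whose main usage emits at most once carries at most one value. -/
theorem emission_unique {D : Decl S} {l : List (ℕ × Val S)} (hl : l.Nodup) {Γ : Ctx S}
    {m d : ℕ × Val S → Var → Res S} (hm : ∀ p ∈ l, EmissionDem D p (m p) (d p))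
    (hb : Below (l.map fun p => m p + d p).sum Γ.toRes)
    {s : ℕ} {v v' : Val S} (hv : (s, v) ∈ l) (hv' : (s, v') ∈ l) {u : Usage} {τ : Ty S}
    (hs : Γ.lookup (.sig s) = some (.sig u τ)) (hk : u.kind.main.c1 = .one) : v = v' := by
  classical
  by_contra hne
  rw [← List.sum_toFinset _ hl] at hb
  -- Two different values on `s` would require two rights to emit on it.
  have h₂ : Below (m (s, v) + m (s, v')) Γ.toRes := by
    refine Below.trans ?_ hb
    have hsub : {(s, v), (s, v')} ⊆ l.toFinset := by
      intro p hp
      rcases Finset.mem_insert.1 hp with rfl | hp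
      · exact List.mem_toFinset.2 hv
      · rw [Finset.mem_singleton.1 hp]; exact List.mem_toFinset.2 hv'
    refine Below.trans ?_ (Below.sum_subset _ hsub)
    rw [Finset.sum_pair (by simpa using hne)]
    exact (Below.left _ _).add (Below.left _ _)
  obtain ⟨c, hc⟩ := h₂
  obtain ⟨Γ₁, h₁⟩ := Ctx.exists_of_below ⟨c, hc⟩
  obtain ⟨Γ₂, h₂⟩ := Ctx.exists_of_below ⟨_, (add_comm _ _).trans hc⟩
  have hΓ : Ctx.Add Γ₁ Γ₂ Γ := Ctx.add_iff.2 (by rw [h₁, h₂, hc])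
  obtain ⟨w, σ, hw, -, e⟩ := hm _ hv
  obtain ⟨w', σ', hw', -, e'⟩ := hm _ hv'
  have h₁ := congrFun h₁ (.sig s)
  rw [e, e', Pi.add_apply, Res.single, Res.single, Pi.single_eq_same, Pi.single_eq_same] at h₁
  rcases Res.ty_add_ty_cases (Ty.sig w σ) (.sig w' σ') with k | ⟨ρ, k, h⟩
  · exact Γ₁.toRes_ne_undef _ (h₁.trans k)
  · have hl := Ctx.toRes_eq_ty.1 (h₁.trans k)
    cases h with
    | @sig _ _ x _ h =>
      obtain ⟨y, hy, hk', -⟩ := hΓ.lookup_sig hl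
      rw [hs] at hy
      cases hy
      have d₁ := w.hd_derived.1
      have d₂ := w'.hd_derived.1
      rw [h.1, ← hk', hk] at d₁
      rw [h.2.1, ← hk', hk] at d₂
      -- Both emit components are nonzero and derived from `1`, so both are `1`, and their sum would
      -- be undefined.
      refine (L.add_eq_one h.2.2.1.1).1 ⟨d₁.resolve_right fun h => hw h.2,
        d₂.resolve_right fun h => hw' h.2⟩

/-! ## The end of the instant preserves typing -/

theorem sum_load {V : ℕ → List (Val S)} (hV : ∀ s, (V s).Nodup) {l : List (ℕ × Val S)}
    (hl : l.Nodup) (hlV : ∀ s v, (s, v) ∈ l ↔ v ∈ V s) (d : ℕ × Val S → Var → Res S)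
    {B : Finset ℕ} (hB : ∀ p ∈ l, p.1 ∈ B) : ∑ s ∈ B, load V d s = (l.map d).sum := by
  classical
  rw [← List.sum_toFinset _ hl,
    Finset.sum_finset_product _ B (fun s => (V s).toFinset) fun p => ?_]
  · exact Finset.sum_congr rfl fun s _ => (List.sum_toFinset _ (hV s)).symm
  · rw [List.mem_toFinset, List.mem_toFinset, ← hlV]
    exact ⟨fun h => ⟨hB p h, h⟩, fun h => h.2⟩

theorem compat_of_add {D : Decl S} {V : ℕ → List (Val S)} {l : List (ℕ × Val S)}
    (hl : l.Nodup) (hlV : ∀ s v, (s, v) ∈ l ↔ v ∈ V s) {Γ Γ' Δ : Ctx S}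
    {m d : ℕ × Val S → Var → Res S} (hm : ∀ p ∈ l, EmissionDem D p (m p) (d p))
    (hb : Below (l.map fun p => m p + d p).sum Γ'.toRes) (hΔ : Ctx.Add Γ Γ' Δ) :
    Compat D V d Γ := by
  intro s u τ hs v hv
  have hp := (hlV s v).2 hv
  obtain ⟨u', τ', hl', hd⟩ := (hm _ hp).lookup
    ((Below.left _ _).trans (below_of_mem hl hb hp))
  obtain ⟨w, -, -, h⟩ := hΔ.lookup_sig hs
  exact (h _ _ hl').1 ▸ hd

/-- The shifted `Γ` pays for the names kept by the arguments, and the shifted `Γ'` for the values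
inserted in place of the dereferenced signals. -/
theorem eoi_typed {D : Decl S} (hD : ∀ f i, (D.funArg f i).IsK) {Γ Γ' Δ : Ctx S} {A : S.Thr}
    {rs : Fin (S.thrArity A) → Rexp S} {V : ℕ → List (Val S)} (hV : ∀ s, (V s).Nodup)
    {PV : Proc S} (hPV : IsPV V PV) (hA : TypedCont D Γ A rs) (hE : Typed D Γ' PV)
    (hΔ : Ctx.Add Γ Γ' Δ) : Typed D Δ.shift (eoiCall V A rs) := by
  classical
  obtain ⟨l, hl, hlV, rfl⟩ := hPV
  obtain ⟨m, d, hm, hb⟩ := hE.emissions_dem hl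
  obtain ⟨Γ₀, Γs, hr, hΓ⟩ := hA
  have hC := compat_of_add hl hlV hm hb hΔ
  let B : Finset ℕ := (l.map Prod.fst).toFinset
  have hlB : ∀ p ∈ l, p.1 ∈ B := fun p hp => List.mem_toFinset.2 (List.mem_map_of_mem hp)
  have hB : ∀ s, s ∉ B → V s = [] := fun s hs =>
    List.eq_nil_iff_forall_not_mem.2 fun v hv => hs (hlB _ ((hlV s v).2 hv))
  choose n hn hnb using fun i =>
    (hr i).exists_dem hD hB (hC.summand (hΓ.ofFn_add i).choose_spec)
  -- The emitted values fit into `Γ'` by their emissions; their types are uniform, so they still fit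
  -- after the shift.
  have hload : Below (∑ s ∈ B, load V d s) Γ'.shift.toRes := by
    rw [sum_load hV hl hlV d hlB]
    refine Res.Steady.below_shift ?_ ?_
    · rw [← List.sum_toFinset _ hl]
      refine Res.Steady.sum _ fun p hp => ?_
      have hp := List.mem_toFinset.1 hp
      obtain ⟨u, τ, hs, hd⟩ := (hm p hp).lookup
        ((Below.left _ _).trans (below_of_mem hl hb hp))
      exact hd.steady hD ((Ty.isRho_sig.1 (Γ'.wf _ _ hs)).imp_right fun h => h.2)
    · refine Below.trans ?_ hb
      rw [← List.sum_toFinset _ hl, ← List.sum_toFinset _ hl]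
      exact Below.sum _ fun p _ => Below.right _ _
  have hsum : Below (∑ i, n i) Δ.shift.toRes := by
    refine (sum_below_budget hΓ hnb).trans ?_
    rw [← Ctx.add_iff.1 hΔ.shift]
    exact (Below.refl _).add ((onceLoad_add_copyLoad_below _ _ _).trans hload)
  obtain ⟨Δ₀, Δs, hs, hsum⟩ := Ctx.exists_sum_of_below hsum
  exact .call (fun i => (hn i).hasTy (hs i ▸ Below.refl _)) hsum

/-! ## Evaluation -/

theorem Val.eval_toTm {D : Decl S} {a : Bool} (v : Val S) : Eval D (v.toTm : Tm S a false) v := by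
  induction v with
  | sig s => exact .sig s
  | con c vs ih => exact .con ih

theorem Eval.toTm_inv {D : Decl S} {a : Bool} {v w : Val S}
    (h : Eval D (v.toTm : Tm S a false) w) : w = v := by
  induction v generalizing w with
  | sig s => cases h; rfl
  | con c vs ih =>
    cases h with
    | con h => exact congrArg _ (funext fun i => ih i (h i))

theorem Eval.fn_subset {D : Decl S} (hD : D.Ok) {a : Bool} {e : Tm S a false} {v : Val S}
    (h : Eval D e v) : ∀ s ∈ v.fn, Var.sig s ∈ e.fv := by
  induction h with
  | sig s => rintro t rfl; exact rfl
  | con _ ih =>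
    intro s hs
    obtain ⟨i, hi⟩ := Set.mem_iUnion.1 hs
    exact Set.mem_iUnion.2 ⟨i, ih i s hi⟩
  | app _ hf ih =>
    intro s hs
    obtain ⟨i, hi⟩ := Set.mem_iUnion.1 (hD.feval_fn _ _ _ hf hs)
    exact Set.mem_iUnion.2 ⟨i, ih i s hi⟩

theorem Val.fv_toTm {a d : Bool} (v : Val S) :
    ∀ x ∈ (v.toTm : Tm S a d).fv, ∃ s ∈ v.fn, x = .sig s := by
  induction v with
  | sig s => rintro x rfl; exact ⟨s, rfl, rfl⟩
  | con c vs ih =>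
    intro x hx
    obtain ⟨i, hi⟩ := Set.mem_iUnion.1 hx
    obtain ⟨s, hs, rfl⟩ := ih i x hi
    exact ⟨s, Set.mem_iUnion.2 ⟨i, hs⟩, rfl⟩

theorem HasTy.eval_typed {D : Decl S} (hD : D.Ok) {Γ : Ctx S} {e : Exp S} {σ : Ty S}
    (h : HasTy D Γ e σ) {v : Val S} (hv : Eval D e v) : HasTy D Γ (v.toTm : Exp S) σ := by
  induction h generalizing v with
  | var h h' => cases hv with | sig s => exact .var h h'
  | con _ hc hs ih => cases hv with | con hv => exact .con (fun i => ih i (hv i)) hc hs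
  | app _ hs ih =>
    cases hv with
    | app hv hf => exact hD.feval_ty _ _ _ _ (.app (fun i => ih i (hv i)) hs) hf

/-- Function symbols have results only on suitably typed arguments, which is why preservation of
typing by evaluation comes first. -/
theorem HasTy.exists_eval {D : Decl S} (hD : D.Ok) {Γ : Ctx S} {e : Exp S} {σ : Ty S}
    (h : HasTy D Γ e σ) (he : ∀ x, Var.var x ∉ e.fv) : ∃ v, Eval D e v := by
  induction h with
  | @var Γ x ρ ρ' h h' =>
    cases x with
    | sig s => exact ⟨_, .sig s⟩
    | var x => exact absurd rfl (he x)
  | con _ hc hs ih =>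
    choose vs hvs using fun i => ih i fun x hx => he x (Set.mem_iUnion.2 ⟨i, hx⟩)
    exact ⟨_, .con hvs⟩
  | app ht hs ih =>
    choose vs hvs using fun i => ih i fun x hx => he x (Set.mem_iUnion.2 ⟨i, hx⟩)
    obtain ⟨v, hv, -⟩ := hD.feval_unique _ _ vs (.app (fun i => (ht i).eval_typed hD (hvs i)) hs)
    exact ⟨v, .app hvs hv⟩

theorem HasTy.eval_unique {D : Decl S} (hD : D.Ok) {Γ : Ctx S} {e : Exp S} {σ : Ty S}
    (h : HasTy D Γ e σ) {v w : Val S} (hv : Eval D e v) (hw : Eval D e w) : v = w := by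
  induction h generalizing v w with
  | var h h' => cases hv; cases hw; rfl
  | con _ hc hs ih =>
    cases hv with
    | con hv =>
      cases hw with
      | con hw => exact congrArg _ (funext fun i => ih i (hv i) (hw i))
  | app ht hs ih =>
    cases hv with
    | @app _ _ _ vs _ hv hf =>
      cases hw with
      | @app _ _ _ ws _ hw hg =>
        obtain rfl : vs = ws := funext fun i => ih i (hv i) (hw i)
        obtain ⟨u, -, hu⟩ := hD.feval_unique _ _ vs
          (.app (fun i => (ht i).eval_typed hD (hv i)) hs)
        exact (hu _ hf).trans (hu _ hg).symm

theorem Eval.var_not_mem_fv {D : Decl S} {a : Bool} {e : Tm S a false} {v : Val S}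
    (h : Eval D e v) (x : ℕ) : Var.var x ∉ e.fv := by
  induction h with
  | sig s => intro h; cases h
  | con _ ih => intro h; obtain ⟨i, hi⟩ := Set.mem_iUnion.1 h; exact ih i hi
  | app _ _ ih => intro h; obtain ⟨i, hi⟩ := Set.mem_iUnion.1 h; exact ih i hi

theorem Tm.var_mem_fv_eoi {a : Bool} (V : ℕ → List (Val S)) (r : Tm S a true) (x : ℕ) :
    Var.var x ∈ (r.eoi V).fv ↔ Var.var x ∈ r.fv := by
  induction r with
  | fvar y => exact Iff.rfl
  | bvar i => exact Iff.rfl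
  | deref h s =>
    cases s with
    | bvar i => exact Iff.rfl
    | name s =>
      constructor
      · intro h
        obtain ⟨t, -, ht⟩ := Val.fv_toTm _ _ h
        cases ht
      · intro h
        cases h
  | con c ts ih => exact Set.mem_iUnion.trans ((exists_congr ih).trans Set.mem_iUnion.symm)
  | app h f ts ih => exact Set.mem_iUnion.trans ((exists_congr ih).trans Set.mem_iUnion.symm)

/-! ## Equivalence of values -/

/-- `nil` and `cons` build both lists and sets, so the constructor alone does not determine its
argument types; the result type does. -/
theorem ConTy.unique {c : Cnst S} {σs σs' : Fin c.arity → Ty S} {σ : Ty S} (h : ConTy c σs σ)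
    (h' : ConTy c σs' σ) : σs = σs' := by
  cases h with
  | ind h =>
    cases h with
    | nil h => exact funext fun i => i.elim0
    | cons h => cases h' with | ind h' => cases h'; rfl
    | other h => cases h' with | ind h' => cases h'; rfl
  | setNil h => exact funext fun i => i.elim0
  | setCons h =>
    cases h' with
    | ind h' => cases h'
    | setCons h' => rfl

/-- Two lists whose elements correspond to each other. -/
def Matching (r : Val S → Val S → Prop) (l l' : List (Val S)) : Prop :=
  (∀ a ∈ l, ∃ b ∈ l', r a b) ∧ ∀ b ∈ l', ∃ a ∈ l, r a b

theorem Val.ofList_injective : Function.Injective (Val.ofList : List (Val S) → Val S) := by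
  intro l
  induction l with
  | nil =>
    intro l' h
    cases l' with
    | nil => rfl
    | cons => cases h
  | cons v l ih =>
    intro l' h
    cases l' with
    | nil => cases h
    | cons w l' =>
      injection h with _ h
      have h0 : v = w := congrFun h (0 : Fin 2)
      have h1 : Val.ofList l = Val.ofList l' := congrFun h (1 : Fin 2)
      rw [h0, ih h1]

theorem ValEq.set_of_matching {x : Mult} {σ : Ty S} {l l' : List (Val S)}
    (h : Matching (ValEq σ) l l') : ValEq (.set x σ) (.ofList l) (.ofList l') := by
  choose! f hf hf' using h.1
  choose! g hg hg' using h.2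
  -- Pairing every element of either list with a partner enumerates both lists in parallel, with
  -- repetitions, so the identity permutation suffices below.
  let L : List (Val S × Val S) := l.map (fun a => (a, f a)) ++ l'.map fun b => (g b, b)
  have hL : ∀ p ∈ L, p.1 ∈ l ∧ p.2 ∈ l' ∧ ValEq σ p.1 p.2 := by
    intro p hp
    rcases List.mem_append.1 hp with hp | hp
    · obtain ⟨a, ha, rfl⟩ := List.mem_map.1 hp
      exact ⟨ha, hf a ha, hf' a ha⟩
    · obtain ⟨b, hb, rfl⟩ := List.mem_map.1 hp
      exact ⟨hg b hb, hb, hg' b hb⟩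
  refine .set (n := L.length) (fun i => (L.get i).1) (fun i => (L.get i).2) 1 ?_ ?_ ?_
  · intro a
    constructor
    · intro ha
      have : (a, f a) ∈ L := List.mem_append_left _ (List.mem_map.2 ⟨a, ha, rfl⟩)
      obtain ⟨i, hi⟩ := List.mem_iff_get.1 this
      exact ⟨i, by rw [hi]⟩
    · rintro ⟨i, rfl⟩
      exact (hL _ (List.get_mem _ _)).1
  · intro b
    constructor
    · intro hb
      have : (g b, b) ∈ L := List.mem_append_right _ (List.mem_map.2 ⟨b, hb, rfl⟩)
      obtain ⟨i, hi⟩ := List.mem_iff_get.1 this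
      exact ⟨i, by rw [hi]⟩
    · rintro ⟨i, rfl⟩
      exact (hL _ (List.get_mem _ _)).2.1
  · exact fun i => (hL _ (List.get_mem _ _)).2.2

/-- Inversion of the generated equivalence at a set type. Reflexivity applies to values that are not
lists, hence the first alternative; matchings are closed under symmetry and composition, and the
constructor clause never yields a set type. -/
theorem ValEq.matching {τ : Ty S} {v u : Val S} (h : ValEq τ v u) {x : Mult} {σ : Ty S}
    (hτ : τ = .set x σ) : v = u ∨ ∃ l l', v = .ofList l ∧ u = .ofList l' ∧
      Matching (ValEq σ) l l' := by
  induction h with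
  | refl => exact Or.inl rfl
  | symm _ ih =>
    rcases ih hτ with h | ⟨l, l', h, h', hm⟩
    · exact Or.inl h.symm
    · exact Or.inr ⟨l', l, h', h, fun b hb => (hm.2 b hb).imp fun _ h => ⟨h.1, h.2.symm⟩,
        fun b hb => (hm.1 b hb).imp fun _ h => ⟨h.1, h.2.symm⟩⟩
  | trans _ _ ih₁ ih₂ =>
    rcases ih₁ hτ with rfl | ⟨l, l', h, h', hm⟩
    · exact ih₂ hτ
    · rcases ih₂ hτ with rfl | ⟨k, k', e, e', hm'⟩
      · exact Or.inr ⟨l, l', h, h', hm⟩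
      · obtain rfl := Val.ofList_injective (h'.symm.trans e)
        refine Or.inr ⟨l, k', h, e', fun a ha => ?_, fun c hc => ?_⟩
        · obtain ⟨b, hb, hab⟩ := hm.1 a ha
          obtain ⟨c, hc, hbc⟩ := hm'.1 b hb
          exact ⟨c, hc, hab.trans hbc⟩
        · obtain ⟨b, hb, hbc⟩ := hm'.2 c hc
          obtain ⟨a, ha, hab⟩ := hm.2 b hb
          exact ⟨a, ha, hab.trans hbc⟩
  | con hc => subst hτ; cases hc
  | @set y τ l l' n v u π hv hu h =>
    cases hτ
    refine Or.inr ⟨l, l', rfl, rfl, fun a ha => ?_, fun b hb => ?_⟩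
    · obtain ⟨i, rfl⟩ := (hv a).1 ha
      exact ⟨_, (hu _).2 ⟨_, rfl⟩, h i⟩
    · obtain ⟨i, rfl⟩ := (hu b).1 hb
      exact ⟨_, (hv _).2 ⟨π.symm i, rfl⟩, by simpa using h (π.symm i)⟩

/-- Contexts give signal names only signal types, so a value of set type is built from `nil` and
`cons`. -/
theorem HasTy.set_value {D : Decl S} {a : Bool} {Γ : Ctx S} {v : Val S} {x : Mult} {σ : Ty S}
    (h : HasTy D Γ (v.toTm : Tm S a false) (.set x σ)) : ∃ l, v = .ofList l := by
  induction v generalizing Γ with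
  | sig s =>
    cases h with
    | var h h' =>
      cases h' with
      | set h' => exact absurd ((Γ.sorted _ _ h).1 trivial) id
  | con c vs ih =>
    cases h with
    | con h hc =>
      cases hc with
      | ind hc => cases hc
      | setNil => exact ⟨[], congrArg _ (funext fun i => i.elim0)⟩
      | setCons =>
        obtain ⟨l, hl⟩ := ih (1 : Fin 2) (h (1 : Fin 2))
        refine ⟨vs (0 : Fin 2) :: l, congrArg _ (funext ?_)⟩
        exact Fin.forall_fin_two.2 ⟨rfl, hl⟩

/-- The equivalence has no congruence clause for `cons` at set types; it is recovered by extending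
the matching of the tails. -/
theorem ValEq.setCons {x : Mult} {σ : Ty S} {a b : Val S} {l l' : List (Val S)}
    (h : ValEq σ a b) (h' : ValEq (.set x σ) (.ofList l) (.ofList l')) :
    ValEq (.set x σ) (.ofList (a :: l)) (.ofList (b :: l')) := by
  have hm : Matching (ValEq σ) l l' := by
    rcases h'.matching rfl with e | ⟨k, k', e, e', hm⟩
    · obtain rfl := Val.ofList_injective e
      exact ⟨fun a ha => ⟨a, ha, .refl _ _⟩, fun a ha => ⟨a, ha, .refl _ _⟩⟩
    · rwa [Val.ofList_injective e, Val.ofList_injective e']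
  refine ValEq.set_of_matching ⟨?_, ?_⟩
  · intro c hc
    rcases List.mem_cons.1 hc with rfl | hc
    · exact ⟨b, List.mem_cons_self, h⟩
    · obtain ⟨d, hd, hcd⟩ := hm.1 c hc
      exact ⟨d, List.mem_cons_of_mem _ hd, hcd⟩
  · intro c hc
    rcases List.mem_cons.1 hc with rfl | hc
    · exact ⟨a, List.mem_cons_self, h⟩
    · obtain ⟨d, hd, hcd⟩ := hm.2 c hc
      exact ⟨d, List.mem_cons_of_mem _ hd, hcd⟩

/-! ### Equivalence of the arguments under two enumerations -/

/-- Emit components of main usages are `1` or `∞`, and only `1` can be turned into `0`. Thus `y`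
comes from a kind with `1`, so `u.hd` has emit component `0` or `1`, which again is possible only in
kinds with `1`. The kind witnessing the comparison need not be that of `u`. -/
theorem Usage.emits_once {u : Usage} {y : U3} (h : U3.Ge u.hd y) (hy : y.c1 = .zero) :
    u.kind.main.c1 = .one := by
  obtain ⟨k, hu, hk, -⟩ := h
  have h₁ := hk.1
  have h₂ := hu.1
  have h₃ := u.hd_derived.1
  rw [hy] at h₁
  generalize u.hd.c1 = a at h₂ h₃
  generalize u.kind = k' at h₃ ⊢
  cases k <;> cases k' <;> simp_all [Kind.main, L.DerivedFrom]

/-- Only list reading is sensitive to the order of `V s`, and there the usage emits at most once, so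
`hΓ` applies. Set reading needs just the same elements, and function symbols respect the
equivalence. -/
theorem HasTyB.eoi_valEq {D : Decl S} (hD : D.Ok) {V V' : ℕ → List (Val S)}
    (hV : ∀ s v, v ∈ V s ↔ v ∈ V' s) {Γ : Ctx S} {r : Rexp S} {σ : Ty S} (h : HasTyB D Γ r σ)
    (hΓ : ∀ s u τ, Γ.lookup (.sig s) = some (.sig u τ) → u.kind.main.c1 = .one → V s = V' s)
    {Θ Θ' : Ctx S} (ht : HasTy D Θ (r.eoi V) σ) (ht' : HasTy D Θ' (r.eoi V') σ)
    {v v' : Val S} (hv : Eval D (r.eoi V) v) (hv' : Eval D (r.eoi V') v') : ValEq σ v v' := by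
  have sub : ∀ {Γ Γ₁ : Ctx S}, (∃ Δ, Ctx.Add Γ₁ Δ Γ) →
      (∀ s u τ, Γ.lookup (.sig s) = some (.sig u τ) → u.kind.main.c1 = .one → V s = V' s) →
      ∀ s u τ, Γ₁.lookup (.sig s) = some (.sig u τ) → u.kind.main.c1 = .one → V s = V' s := by
    rintro Γ Γ₁ ⟨Δ, h⟩ hΓ s u τ hs hu
    obtain ⟨w, hw, hk, -⟩ := h.lookup_sig hs
    exact hΓ s w τ hw (hk ▸ hu)
  induction h generalizing Θ Θ' v v' with
  | varC h h' => cases hv; cases hv'; exact .refl _ _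
  | varSig h h' => cases hv; cases hv'; exact .refl _ _
  | @con Γ₀ Γ c Γs rs σs σ _ hc hs ih =>
    have ih := fun i => @ih i (sub (hs.ofFn_add i) hΓ)
    cases ht with
    | @con _ _ _ _ _ σs₁ _ ht hc₁ hs₁ =>
    cases ht' with
    | @con _ _ _ _ _ σs₂ _ ht' hc₂ hs₂ =>
    obtain rfl := hc.unique hc₁
    obtain rfl := hc.unique hc₂
    cases hv with
    | @con _ _ vs hv =>
    cases hv' with
    | @con _ _ vs' hv' =>
    have ih := fun i => ih i (ht i) (ht' i) (hv i) (hv' i)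
    have ht := fun i => (ht i).eval_typed hD (hv i)
    have ht' := fun i => (ht' i).eval_typed hD (hv' i)
    -- `ValEq.con` covers inductive types only; for sets, the tails are first shown to be lists.
    cases hc with
    | ind hc => exact .con hc ih
    | setNil h =>
      obtain rfl : vs = vs' := funext fun i => i.elim0
      exact .refl _ _
    | setCons h =>
      obtain ⟨l, hl⟩ := (ht (1 : Fin 2)).set_value
      obtain ⟨l', hl'⟩ := (ht' (1 : Fin 2)).set_value
      have e : Val.con .cons vs = .ofList (vs (0 : Fin 2) :: l) :=
        congrArg _ (funext (Fin.forall_fin_two.2 ⟨rfl, hl⟩))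
      have e' : Val.con .cons vs' = .ofList (vs' (0 : Fin 2) :: l') :=
        congrArg _ (funext (Fin.forall_fin_two.2 ⟨rfl, hl'⟩))
      rw [e, e']
      have h₁ := ih (1 : Fin 2)
      rw [hl, hl'] at h₁
      exact (ih (0 : Fin 2)).setCons h₁
  | app _ hs ih =>
    have ih := fun i => @ih i (sub (hs.ofFn_add i) hΓ)
    cases ht with
    | app ht hs₁ =>
    cases ht' with
    | app ht' hs₂ =>
    cases hv with
    | app hv hf =>
    cases hv' with
    | app hv' hf' =>
    exact hD.feval_eq _ _ _ _ _ (fun i => ih i (ht i) (ht' i) (hv i) (hv' i)) hf hf'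
  | @derefSet Γ s u σ x h hx =>
    obtain rfl := Eval.toTm_inv hv
    obtain rfl := Eval.toTm_inv hv'
    exact .set_of_matching ⟨fun a ha => ⟨a, (hV s a).1 ha, .refl _ _⟩,
      fun a ha => ⟨a, (hV s a).2 ha, .refl _ _⟩⟩
  | @derefList Γ s u σ x h hx =>
    obtain rfl := Eval.toTm_inv hv
    obtain rfl := Eval.toTm_inv hv'
    rw [hΓ s u σ h (hx.elim (fun h => Usage.emits_once h.1 rfl)
      fun h => Usage.emits_once h.1 rfl)]
    exact .refl _ _

/-! ## Bisimilarity of calls -/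

/-- The parallel composition of a program and emissions. -/
def Proc.wrap (P : Proc S) : List (Bool × ℕ × Exp S) → Proc S
  | [] => P
  | (m, s, e) :: l => .par (P.wrap l) (.emit m (.name s) e)

/-- Parallel compositions of calls and emissions. -/
def Proc.Flat : Proc S → Prop
  | .call _ _ => True
  | .emit _ _ _ => True
  | .par P Q => P.Flat ∧ Q.Flat
  | _ => False

theorem Proc.flat_wrap (A : S.Thr) (es : Fin (S.thrArity A) → Exp S)
    (l : List (Bool × ℕ × Exp S)) : ((Proc.call A es).wrap l).Flat := by
  induction l with
  | nil => trivial
  | cons p l ih => exact ⟨ih, trivial⟩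

theorem LiftsTo.eq_of_flat {P Q : Proc S} (h : LiftsTo P Q) (hP : P.Flat) : Q = P := by
  induction h with
  | refl => rfl
  | trans _ _ ih₁ ih₂ =>
    obtain rfl := ih₁ hP
    exact ih₂ hP
  | par _ _ ih₁ ih₂ => rw [ih₁ hP.1, ih₂ hP.2]
  | left => exact absurd hP.1 id
  | right => exact absurd hP.2 id
  | nu => exact absurd hP id
  | present => exact absurd hP id
  | matchSig => exact absurd hP id
  | matchCon => exact absurd hP id

theorem Step.wrap_eoi_false {D : Decl S} {A : S.Thr} {es : Fin (S.thrArity A) → Exp S}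
    {l : List (Bool × ℕ × Exp S)} {E : ℕ → Finset (Val S)} {V : ℕ → List (Val S)} {P' : Proc S}
    (h : Step D ((Proc.call A es).wrap l) (.eoi E V) P') : False := by
  induction l generalizing E P' with
  | nil => cases h
  | cons p l ih => cases h with | par h _ => exact ih h

/-- There is nothing to lift in a parallel composition of calls and emissions, and a call has no
end-of-instant transition. -/
theorem Step.wrap_next_false {D : Decl S} {A : S.Thr} {es : Fin (S.thrArity A) → Exp S}
    {l : List (Bool × ℕ × Exp S)} {P' : Proc S}
    (h : Step D ((Proc.call A es).wrap l) .next P') : False := by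
  generalize hP : (Proc.call A es).wrap l = P at h
  cases h with
  | @next _ Q P'' ts E V hQ hl hV hs =>
    subst hP
    have h := hl.eq_of_flat (Proc.flat_wrap _ _ _)
    cases ts with
    | nil =>
      obtain rfl : Q = _ := h
      exact hs.wrap_eoi_false
    | cons t ts =>
      have hf := Proc.flat_wrap A es l
      rw [← h] at hf
      exact hf

theorem Step.emit_inv {D : Decl S} {m : Bool} {s : SigRef} {e : Exp S} {μ : Nest S} {P' : Proc S}
    (h : Step D (.emit m s e) (.nest μ) P') :
    ∃ t v, s = .name t ∧ Eval D e v ∧ μ = .out [] t v ∧ P' = .emit true (.name t) e := by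
  cases h with
  | out h => exact ⟨_, _, rfl, h, rfl, rfl⟩

/-- The transitions of a call next to emissions are those of the emissions, which do not depend
on the arguments of the call, and the unfolding of the call. -/
theorem Step.wrap_nest {D : Decl S} {A : S.Thr} {es : Fin (S.thrArity A) → Exp S}
    {l : List (Bool × ℕ × Exp S)} {μ : Nest S} {P' : Proc S}
    (h : Step D ((Proc.call A es).wrap l) (.nest μ) P') :
    (∃ s v l', μ = .out [] s v ∧ P' = (Proc.call A es).wrap l' ∧
      ∀ es', Step D ((Proc.call A es').wrap l) (.nest μ) ((Proc.call A es').wrap l')) ∨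
    (μ = .tau ∧ ∃ vs θ, (∀ i, Eval D (es i) (vs i)) ∧ θ.Binds (D.params A) vs ∧
      P' = ((D.body A).subst θ).wrap l) := by
  induction l generalizing μ P' with
  | nil =>
    cases h with
    | call hv hθ => exact Or.inr ⟨rfl, _, _, hv, hθ, rfl⟩
  | cons p l ih =>
    obtain ⟨m, s, e⟩ := p
    cases h with
    | compL h hd =>
      rcases ih h with ⟨s', v, l', rfl, rfl, h'⟩ | ⟨rfl, vs, θ, hv, hθ, rfl⟩
      · exact Or.inl ⟨s', v, (m, s, e) :: l', rfl, rfl, fun es' => .compL (h' es') hd⟩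
      · exact Or.inr ⟨rfl, vs, θ, hv, hθ, rfl⟩
    | compR h hd =>
      obtain ⟨t, v, ht, hv, rfl, rfl⟩ := h.emit_inv
      cases ht
      exact Or.inl ⟨s, v, (true, s, e) :: l, rfl, rfl, fun es' => .compR (.out hv) (by
        simp [Nest.bn])⟩
    | synchL _ h _ =>
      obtain ⟨_, _, _, _, h, _⟩ := h.emit_inv
      cases h
    | synchR h _ _ =>
      rcases ih h with ⟨_, _, _, h, _⟩ | ⟨h, _⟩ <;> cases h

theorem Step.wrap_unfold {D : Decl S} {A : S.Thr} {es : Fin (S.thrArity A) → Exp S}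
    {vs : Fin (S.thrArity A) → Val S} {θ : Sub S} (hv : ∀ i, Eval D (es i) (vs i))
    (hθ : θ.Binds (D.params A) vs) (l : List (Bool × ℕ × Exp S)) :
    Step D ((Proc.call A es).wrap l) (.nest .tau) (((D.body A).subst θ).wrap l) := by
  induction l with
  | nil => exact .call hv hθ
  | cons p l ih => exact .compL ih (by simp [Nest.bn])

/-! ### Calls whose arguments have the same values -/

/-- The lists of expressions `es` and `es'` have the same values. -/
def SameEval (D : Decl S) {n : ℕ} (es es' : Fin n → Exp S) : Prop :=
  ∀ vs : Fin n → Val S, (∀ i, Eval D (es i) (vs i)) ↔ ∀ i, Eval D (es' i) (vs i)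

theorem SameEval.symm {D : Decl S} {n : ℕ} {es es' : Fin n → Exp S} (h : SameEval D es es') :
    SameEval D es' es :=
  fun vs => (h vs).symm

/-- `P` and `Q` are equal, or the calls of `A` with `es` and `es'` next to the same emissions. -/
def SameCall {A : S.Thr} (es es' : Fin (S.thrArity A) → Exp S) (P Q : Proc S) : Prop :=
  P = Q ∨ ∃ l : List (Bool × ℕ × Exp S),
    P = (Proc.call A es).wrap l ∧ Q = (Proc.call A es').wrap l

theorem SameCall.of_call {A : S.Thr} {es es' : Fin (S.thrArity A) → Exp S} :
    SameCall es es' (.call A es) (.call A es') :=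
  Or.inr ⟨[], rfl, rfl⟩

theorem SameCall.symm {A : S.Thr} {es es' : Fin (S.thrArity A) → Exp S} {P Q : Proc S}
    (h : SameCall es es' P Q) : SameCall es' es Q P :=
  h.imp Eq.symm fun ⟨l, h, h'⟩ => ⟨l, h', h⟩

theorem Proc.fv_wrap_subset {P Q : Proc S} (h : P.fv ⊆ Q.fv) (l : List (Bool × ℕ × Exp S)) :
    (P.wrap l).fv ⊆ (Q.wrap l).fv := by
  induction l with
  | nil => exact h
  | cons p l ih => exact Set.union_subset_union_left _ ih

theorem SameCall.fn_subset {A : S.Thr} {es es' : Fin (S.thrArity A) → Exp S} {P Q : Proc S}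
    (h : SameCall es es' P Q) (hfv : (Proc.call A es').fv ⊆ (Proc.call A es).fv) :
    Q.fn ⊆ P.fn := by
  rcases h with rfl | ⟨l, rfl, rfl⟩
  · exact Set.Subset.rfl
  · exact fun s hs => Proc.fv_wrap_subset hfv l hs

/-- Outputs and inputs leave the call in place and only change the emissions beside it. Unfolding
the call forgets the expressions and keeps their values, after which the two programs are equal. -/
theorem SameCall.step {D : Decl S} {A : S.Thr} {es es' : Fin (S.thrArity A) → Exp S}
    (he : SameEval D es es') {P Q P' : Proc S} (h : SameCall es es' P Q) {α : Act S}
    (hα : α.Relevant) (hs : Step D P α P') : ∃ Q', Step D Q α Q' ∧ SameCall es es' P' Q' := by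
  rcases h with rfl | ⟨l, rfl, rfl⟩
  · exact ⟨P', hs, Or.inl rfl⟩
  · cases α with
    | nest μ =>
      rcases hs.wrap_nest with ⟨s, v, l', rfl, rfl, h'⟩ | ⟨rfl, vs, θ, hv, hθ, rfl⟩
      · exact ⟨_, h' es', Or.inr ⟨l', rfl, rfl⟩⟩
      · exact ⟨_, Step.wrap_unfold ((he vs).1 hv) hθ l, Or.inl rfl⟩
    | inp s v =>
      obtain rfl : P' = (Proc.call A es).wrap ((false, s, v.toTm) :: l) := by
        generalize hP : (Proc.call A es).wrap l = P at hs
        cases hs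
        subst hP
        rfl
      exact ⟨_, .inp s v, Or.inr ⟨(false, s, v.toTm) :: l, rfl, rfl⟩⟩
    | next => exact hs.wrap_next_false.elim
    | eoi E V => exact hα.elim

theorem SameCall.tauStar {D : Decl S} {A : S.Thr} {es es' : Fin (S.thrArity A) → Exp S}
    (he : SameEval D es es') {P Q P' : Proc S} (h : SameCall es es' P Q)
    (hs : TauStar D P P') : ∃ Q', TauStar D Q Q' ∧ SameCall es es' P' Q' := by
  induction hs with
  | refl => exact ⟨Q, .refl, h⟩
  | tail _ hs ih =>
    obtain ⟨Q₁, h₁, h⟩ := ih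
    obtain ⟨Q₂, h₂, h⟩ := h.step he (α := .nest .tau) trivial hs
    exact ⟨Q₂, h₁.tail h₂, h⟩

theorem SameCall.wstep {D : Decl S} {A : S.Thr} {es es' : Fin (S.thrArity A) → Exp S}
    (he : SameEval D es es') {P Q P' : Proc S} (h : SameCall es es' P Q) {α : Act S}
    (hα : α.Relevant) (hs : WStep D α P P') : ∃ Q', WStep D α Q Q' ∧ SameCall es es' P' Q' := by
  have key : Relation.Comp (Relation.Comp (TauStar D) (fun P Q => Step D P α Q)) (TauStar D) P P' →
      ∃ Q', Relation.Comp (Relation.Comp (TauStar D) (fun P Q => Step D P α Q)) (TauStar D) Q Q' ∧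
        SameCall es es' P' Q' := by
    rintro ⟨P₂, ⟨P₁, h₁, h₂⟩, h₃⟩
    obtain ⟨Q₁, k₁, h⟩ := h.tauStar he h₁
    obtain ⟨Q₂, k₂, h⟩ := h.step he hα h₂
    obtain ⟨Q₃, k₃, h⟩ := h.tauStar he h₃
    exact ⟨Q₃, ⟨Q₂, ⟨Q₁, k₁, k₂⟩, k₃⟩, h⟩
  cases α with
  | nest μ =>
    cases μ with
    | tau => exact h.tauStar he hs
    | out ts s v => exact key hs
    | recv s v => exact key hs
  | inp s v => exact key hs
  | eoi E V => exact key hs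
  | next =>
    obtain ⟨P₁, h₁, h₂⟩ := hs
    obtain ⟨Q₁, k₁, h⟩ := h.tauStar he h₁
    obtain ⟨Q₂, k₂, h⟩ := h.step he hα h₂
    exact ⟨Q₂, ⟨Q₁, k₁, k₂⟩, h⟩

theorem WStep.of_step {D : Decl S} {P P' : Proc S} {α : Act S} (h : Step D P α P') :
    WStep D α P P' := by
  cases α with
  | nest μ =>
    cases μ with
    | tau => exact .single h
    | out ts s v => exact ⟨_, ⟨_, .refl, h⟩, .refl⟩
    | recv s v => exact ⟨_, ⟨_, .refl, h⟩, .refl⟩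
  | inp s v => exact ⟨_, ⟨_, .refl, h⟩, .refl⟩
  | eoi E V => exact ⟨_, ⟨_, .refl, h⟩, .refl⟩
  | next => exact ⟨_, .refl, h⟩

theorem SameEval.bisim_call {D : Decl S} {A : S.Thr} {es es' : Fin (S.thrArity A) → Exp S}
    (he : SameEval D es es') : Bisim D (.call A es) (.call A es') := by
  refine ⟨fun P Q => ∃ es es' : Fin (S.thrArity A) → Exp S, SameEval D es es' ∧
    SameCall es es' P Q, ⟨?_, ?_⟩, es, es', he, .of_call⟩
  · rintro P Q ⟨es, es', he, h⟩
    exact ⟨es', es, he.symm, h.symm⟩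
  · rintro P Q α P' ⟨es, es', he, h⟩ hα hs -
    obtain ⟨Q', hs', h'⟩ := h.step he hα hs
    exact ⟨Q', .of_step hs', es, es', he, h'⟩

theorem Bisim.symm {D : Decl S} {P Q : Proc S} (h : Bisim D P Q) : Bisim D Q P := by
  obtain ⟨R, hR, h⟩ := h
  exact ⟨R, hR, hR.1 _ _ h⟩

theorem Bisim.step {D : Decl S} {P Q P' : Proc S} (h : Bisim D P Q) {α : Act S}
    (hα : α.Relevant) (hs : Step D P α P') (hd : Disjoint α.bn Q.fn) :
    ∃ Q', WStep D α Q Q' ∧ Bisim D P' Q' := by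
  obtain ⟨R, hR, h⟩ := h
  obtain ⟨Q', h₁, h₂⟩ := hR.2 _ _ _ _ h hα hs hd
  exact ⟨Q', h₁, R, hR, h₂⟩

/-- The relation between the programs that become bisimilar when some calls are evaluated. -/
def EvalBisim (D : Decl S) (P Q : Proc S) : Prop :=
  ∃ (A B : S.Thr) (es es' : Fin (S.thrArity A) → Exp S) (fs fs' : Fin (S.thrArity B) → Exp S)
    (P₁ Q₁ : Proc S), SameEval D es es' ∧ (Proc.call A es').fv ⊆ (Proc.call A es).fv ∧
    SameEval D fs fs' ∧ (Proc.call B fs').fv ⊆ (Proc.call B fs).fv ∧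
    SameCall es es' P P₁ ∧ SameCall fs fs' Q Q₁ ∧ Bisim D P₁ Q₁

/-- A step is carried to the evaluated call, answered there by bisimilarity, and carried back. The
inclusion of free variables guarantees that bound names fresh for `Q` are fresh for the evaluated
program as well. -/
theorem EvalBisim.isBisim (D : Decl S) : IsBisim D (EvalBisim D) := by
  constructor
  · rintro P Q ⟨A, B, es, es', fs, fs', P₁, Q₁, he, hse, hf, hsf, hP, hQ, h⟩
    exact ⟨B, A, fs, fs', es, es', Q₁, P₁, hf, hsf, he, hse, hQ, hP, h.symm⟩
  · rintro P Q α P' ⟨A, B, es, es', fs, fs', P₁, Q₁, he, hse, hf, hsf, hP, hQ, h⟩ hα hs hd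
    obtain ⟨P₂, hs₁, hP₂⟩ := hP.step he hα hs
    obtain ⟨Q₂, hs₂, h₂⟩ := h.step hα hs₁ (hd.mono_right (hQ.fn_subset hsf))
    obtain ⟨Q', hs', hQ'⟩ := hQ.symm.wstep hf.symm hα hs₂
    exact ⟨Q', hs', A, B, es, es', fs, fs', P₂, Q₂, he, hse, hf, hsf, hP₂, hQ'.symm, h₂⟩

/-- Calls are bisimilar if they are after the evaluation of the arguments. -/
theorem Bisim.of_eval {D : Decl S} (hD : D.Ok) {A : S.Thr} {es es' : Fin (S.thrArity A) → Exp S}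
    {vs vs' : Fin (S.thrArity A) → Val S} (hv : ∀ i, Eval D (es i) (vs i))
    (hv' : ∀ i, Eval D (es' i) (vs' i))
    (hu : ∀ i w, Eval D (es i) w → w = vs i) (hu' : ∀ i w, Eval D (es' i) w → w = vs' i)
    (h : Bisim D (.call A fun i => (vs i).toTm) (.call A fun i => (vs' i).toTm)) :
    Bisim D (.call A es) (.call A es') := by
  have key : ∀ {es : Fin (S.thrArity A) → Exp S} {vs : Fin (S.thrArity A) → Val S},
      (∀ i, Eval D (es i) (vs i)) → (∀ i w, Eval D (es i) w → w = vs i) →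
      SameEval D es (fun i => (vs i).toTm) ∧
        (Proc.call A fun i => (vs i).toTm).fv ⊆ (Proc.call A es).fv := by
    intro es vs hv hu
    refine ⟨fun ws => ⟨fun h i => ?_, fun h i => ?_⟩, fun x hx => ?_⟩
    · rw [hu i _ (h i)]
      exact Val.eval_toTm _
    · rw [(h i).toTm_inv]
      exact hv i
    · obtain ⟨i, hi⟩ := Set.mem_iUnion.1 hx
      obtain ⟨s, hs, rfl⟩ := Val.fv_toTm _ _ hi
      -- Evaluation creates no names, since results of functions contain only names of their
      -- arguments.
      exact Set.mem_iUnion.2 ⟨i, (hv i).fn_subset hD s hs⟩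
  exact ⟨EvalBisim D, EvalBisim.isBisim D, A, A, es, _, es', _, _, _, (key hv hu).1, (key hv hu).2,
    (key hv' hu').1, (key hv' hu').2, .of_call, .of_call, h⟩

/-! ### Bisimilarity of the continuations under two enumerations -/

theorem Typed.call_inv {D : Decl S} {Γ : Ctx S} {A : S.Thr} {es : Fin (S.thrArity A) → Exp S}
    (h : Typed D Γ (.call A es)) : ∀ i, ∃ Δ, HasTy D Δ (es i) (D.thrArg A i) := by
  cases h with
  | call h _ => exact fun i => ⟨_, h i⟩

/-- At most one value is emitted on `s`, and a list with at most one element is determined by its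
members. -/
theorem IsPV.eq_of_emits_once {D : Decl S} {V V' : ℕ → List (Val S)} (hV : ∀ s, (V s).Nodup)
    (hV' : ∀ s, (V' s).Nodup) (hVV : ∀ s v, v ∈ V s ↔ v ∈ V' s) {PV : Proc S} (hPV : IsPV V PV)
    {Γ : Ctx S} (hE : Typed D Γ PV) {s : ℕ}
    (hs : ∀ u τ, Γ.lookup (.sig s) = some (.sig u τ) → u.kind.main.c1 = .one) : V s = V' s := by
  obtain ⟨l, hl, hlV, rfl⟩ := hPV
  obtain ⟨m, d, hm, hb⟩ := hE.emissions_dem hl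
  have key : ∀ v ∈ V s, ∀ w ∈ V s, v = w := by
    intro v hv w hw
    have hv := (hlV s v).2 hv
    obtain ⟨u, τ, h, -⟩ := (hm _ hv).lookup ((Below.left _ _).trans (below_of_mem hl hb hv))
    exact emission_unique hl hm hb hv ((hlV s w).2 hw) h (hs _ _ h)
  have hp := (List.perm_ext_iff_of_nodup (hV s) (hV' s)).2 (hVV s)
  have hk := hV s
  generalize V s = k at key hp hk
  match k with
  | [] => exact hp.nil_eq
  | [v] => exact (List.perm_singleton.1 hp.symm).symm
  | v :: w :: k =>
    have hvw := key v List.mem_cons_self w (List.mem_cons_of_mem _ List.mem_cons_self)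
    exact absurd (hvw ▸ List.mem_cons_self) (List.nodup_cons.1 hk).1

theorem eoi_bisim {D : Decl S} (hD : D.Ok) {Γ Γ' Δ : Ctx S} {A : S.Thr}
    {rs : Fin (S.thrArity A) → Rexp S} {V V' : ℕ → List (Val S)} (hV : ∀ s, (V s).Nodup)
    (hV' : ∀ s, (V' s).Nodup) (hVV : ∀ s v, v ∈ V s ↔ v ∈ V' s) {PV : Proc S} (hPV : IsPV V PV)
    (hA : TypedCont D Γ A rs) (hE : Typed D Γ' PV) (hΔ : Ctx.Add Γ Γ' Δ) :
    Bisim D (eoiCall V A rs) (eoiCall V' A rs) := by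
  -- Being a program `P_V` depends only on the members of the lists, so the same emissions serve
  -- `V'` and part (1) types both calls.
  have hPV' : IsPV V' PV := by
    obtain ⟨l, hl, hlV, e⟩ := hPV
    exact ⟨l, hl, fun s v => (hlV s v).trans (hVV s v), e⟩
  choose Θ ht using (eoi_typed hD.funArg_K hV hPV hA hE hΔ).call_inv
  choose Θ' ht' using (eoi_typed hD.funArg_K hV' hPV' hA hE hΔ).call_inv
  by_cases hc : ∀ i x, Var.var x ∉ (rs i).fv
  · choose vs hv using fun i =>
      (ht i).exists_eval hD fun x hx => hc i x ((Tm.var_mem_fv_eoi V _ x).1 hx)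
    choose vs' hv' using fun i =>
      (ht' i).exists_eval hD fun x hx => hc i x ((Tm.var_mem_fv_eoi V' _ x).1 hx)
    refine Bisim.of_eval hD hv hv' (fun i w hw => (ht i).eval_unique hD hw (hv i))
      (fun i w hw => (ht' i).eval_unique hD hw (hv' i)) (hD.thr_eq A vs vs' fun i => ?_)
    obtain ⟨Γ₀, Γs, hr, hΓ⟩ := hA
    refine (hr i).eoi_valEq hD hVV (fun s u τ hs hu => ?_) (ht i) (ht' i) (hv i) (hv' i)
    -- The kind of the usage passes from the context of one argument to `Γ`, and from there to `Γ'`,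
    -- where emissions are counted.
    obtain ⟨w, hw, hk, -⟩ := (hΓ.ofFn_add i).choose_spec.lookup_sig hs
    obtain ⟨_, -, -, hΓ'⟩ := hΔ.lookup_sig hw
    refine hPV.eq_of_emits_once hV hV' hVV hE fun u' τ' hs' => ?_
    rw [(hΓ' _ _ hs').2, hk, hu]
  -- A variable that is not a signal name has no value, and replacing `!s` by values neither adds
  -- nor removes such variables; so neither call can be evaluated.
  · push Not at hc
    obtain ⟨i, x, hx⟩ := hc
    refine SameEval.bisim_call fun vs => ⟨fun h => ?_, fun h => ?_⟩
    · exact absurd ((Tm.var_mem_fv_eoi V _ x).2 hx) ((h i).var_not_mem_fv x)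
    · exact absurd ((Tm.var_mem_fv_eoi V' _ x).2 hx) ((h i).var_not_mem_fv x)

end

end SPi

theorem lemma4 {S : SPi.Sgn} (D : SPi.Decl S) (hD : D.Ok)
    (Γ Γ' Δ : SPi.Ctx S) (A : S.Thr) (rs : Fin (S.thrArity A) → SPi.Rexp S)
    (V : ℕ → List (SPi.Val S)) (hV : ∀ s, (V s).Nodup)
    (PV : SPi.Proc S) (hPV : SPi.IsPV V PV)
    (hA : SPi.TypedCont D Γ A rs) (hE : SPi.Typed D Γ' PV) (hΔ : SPi.Ctx.Add Γ Γ' Δ) :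
    SPi.Typed D Δ.shift (SPi.eoiCall V A rs) ∧
      ∀ (V' : ℕ → List (SPi.Val S)) (E : ℕ → Finset (SPi.Val S)),
        SPi.Represents V E → SPi.Represents V' E →
          SPi.Bisim D (SPi.eoiCall V A rs) (SPi.eoiCall V' A rs) := by
  refine ⟨SPi.eoi_typed hD.funArg_K hV hPV hA hE hΔ, fun V' E h h' => ?_⟩
  exact SPi.eoi_bisim hD hV (fun s => (h' s).1)
    (fun s v => ((h s).2 v).trans ((h' s).2 v).symm) hPV hA hE hΔ
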